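/- **Theorem (correctness and finiteness of the LFG algorithm).** Let $A\in\mathbb Z^{m\times n}$, $b\in\mathbb Z^m$, $C\in\mathbb Z^{l\times n}$, $d\in\mathbb Z^l$ be arbitrary integer data. Write $a_i,c_k$ for the rows of $A,C$. The LFG algorithm, described below and run in exact real arithmetic on the system $$Ax=b,\qquad Cx\le d,\qquad x\in\mathbb R^n, \tag{1}$$ is correct and finite: there is a number $B$, depending only on the input, such that for all admissible choices made during the run every execution stops after at most $B$ steps; it never gets stuck; and when it stops it has either returned a point $\hat x\in\mathbb R^n$ with $A\hat x=b$, $C\hat x\le d$, or declared infeasibility, the latter only if (1) has no solution $x\in\mathbb R^n$. (A step is one step of the descriptions below; the recursive calls of D&C are counted.) *The Elementary Procedure* EP for a system $Ax=b,\ Cx\le d$ at $(z,r)$. Let $p$ be the orthogonal projection of $z$ onto $\{y: Ay=b\}$. If $\|p-z\|<r$ and $(c_kz-d_k)/\|c_k\|<r$ for all $k$, return the solution $p$. Else, if $\|p-z\|\ge r$, return the hyperplane $hx=\delta$ with $h=z-p$, $\delta=h\cdot p$. Else choose $k$ with $(c_kz-d_k)/\|c_k\|\ge r$ and return the hyperplane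 $c_kx=d_k$. *The D&C algorithm* at $(z,r,\varepsilon)$, with $\theta=2/5$. If $r\le\varepsilon/(2\max_k\|c_k\|)$, return the result of EP at $(z,r)$. Otherwise call D&C at $(z,\frac r{1+\theta},\varepsilon)$. If it returns a solution, return that solution; if it fails, fail; if it returns $h_1x=\delta_1$, put $z_0=z-\frac{h_1z-\delta_1}{h_1\cdot h_1}h_1$ and call D&C at $(z_0,\frac r{1+\theta},\varepsilon)$. If this returns a solution, return it; if it fails, fail; if it returns $h_2x=\delta_2$, then fail if $h_1=-\gamma h_2$ for some $\gamma>0$, and otherwise choose $\alpha\in[0,1]$ such that $h=\alpha h_1+(1-\alpha)h_2$ and $\delta=\alpha\delta_1+(1-\alpha)\delta_2$ satisfy $(hz-\delta)/\|h\|\ge r$, and return $hx=\delta$. *The LFG algorithm.* Let $T$ be the bit length of the input, that is, the sum of $1+\lceil\log_2(|a|+1)\rceil$ over all entries $a$ of $A,b,C,d$, and let $\nu=2^{-2T}$. Relax (1) to $Ax=b,\ Cx\le d+\frac\nu2\mathbf 1$, homogenize it to $Ax-bt=0,\ Cx-(d+\frac\nu2\mathbf 1)t\le0,\ -t\le-1$,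 and strengthen it to $$Ax-bt=0,\qquad Cx-(d+\tfrac\nu2\mathbf 1)t\le-\mathbf 1,\qquad -t\le-2. \tag{2}$$ Run D&C once on (2) with $z=0$, $\varepsilon=1$ and $r=2^{5(n+1)^2\varphi}\sqrt{n+1}$, where $\varphi$ is the facet complexity of the solution set $P\subseteq\mathbb R^{n+1}$ of (2): the least integer $\varphi\ge n+1$ such that $P$ is defined by a finite system of rational linear inequalities each of size at most $\varphi$. Here a rational $p/q$ in lowest terms has size $1+\lceil\log_2(|p|+1)\rceil+\lceil\log_2(|q|+1)\rceil$, a vector has size its number of entries plus the sum of the sizes of its entries, and $ax\le\beta$ has size $1+\mathrm{size}(a)+\mathrm{size}(\beta)$. If D&C fails or returns a hyperplane, declare infeasibility. If D&C returns $(x^*,t^*)$, start from $x=x^*/t^*$ and round as follows. *Rounding.* Let $L_x=\{k: d_k\le c_kx<d_k+\nu\}$. While some $c_k$ with $k\notin L_x$ is not in the linear span of all $a_i$ and of the $c_j$, $j\in L_x$, choose such a $k$ and a vector $w$ with $Aw=0$, $c_jw=0$ for $j\in L_x$, and $c_kw=1$, and replace $x$ by $x+\lambda w$, where $\lambda=\min\{(d_j-c_jx)/(c_jw):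 j\notin L_x,\ c_jw>0\}$. When there is no such $k$, choose a set $I'$ of rows of $A$ and a set $L'\subseteq L_x$ such that $\{a_i\}_{i\in I'}$ spans the row space of $A$ and $\{a_i\}_{i\in I'}\cup\{c_j\}_{j\in L'}$ is a linearly independent family with the same span as all the $a_i$ together with the $c_j$, $j\in L_x$; return any $\hat x$ with $a_i\hat x=b_i$ ($i\in I'$) and $c_j\hat x=d_j$ ($j\in L'$). -/

import Mathlib

open scoped Matrix

noncomputable section

namespace LFG

/-! ## Linear systems `A x = b`, `C x ≤ d` -/

/-- A real linear system `A x = b`, `C x ≤ d`; equations are indexed by `I`, inequalities by `K`,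
variables by `J`. -/
structure LinSys (I K J : Type) where
  A : Matrix I J ℝ
  b : I → ℝ
  C : Matrix K J ℝ
  d : K → ℝ

namespace LinSys

variable {I K J : Type}

/-- `x` solves `A x = b`, `C x ≤ d`. -/
def Feasible [Fintype J] (S : LinSys I K J) (x : J → ℝ) : Prop :=
  S.A *ᵥ x = S.b ∧ ∀ k, (S.C *ᵥ x) k ≤ S.d k

/-- The relaxed system `A x = b`, `C x ≤ d + η 1`. -/
def relax (S : LinSys I K J) (η : ℝ) : LinSys I K J where
  A := S.A
  b := S.b
  C := S.C
  d := fun k => S.d k + η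

/-- The parameterized (homogenized) system in the variables `(x, t)`:
`A x - b t = 0`, `C x - d t ≤ 0`, `-t ≤ -1`. -/
def parameterize (S : LinSys I K J) : LinSys I (K ⊕ Unit) (J ⊕ Unit) where
  A := Matrix.fromCols S.A (Matrix.of fun i _ => -S.b i)
  b := 0
  C := Matrix.fromBlocks S.C (Matrix.of fun k _ => -S.d k) 0 (Matrix.of fun _ _ => -1)
  d := Sum.elim (fun _ => 0) (fun _ => -1)

/-- The strengthened system `A x = b`, `C x ≤ d - ε 1`. -/
def strengthen (S : LinSys I K J) (ε : ℝ) : LinSys I K J where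
  A := S.A
  b := S.b
  C := S.C
  d := fun k => S.d k - ε

/-- The `k`-th row `c_k` of `C` as a Euclidean vector. -/
def row (S : LinSys I K J) (k : K) : EuclideanSpace ℝ J := WithLp.toLp 2 (S.C k)

/-- `‖c_max‖`, the largest Euclidean norm of a row of `C`. -/
def normCmax [Fintype J] (S : LinSys I K J) : ℝ := ⨆ k, ‖S.row k‖

/-- `p` is the orthogonal projection of `z` onto the affine subspace `{y | A y = b}`. -/
def IsProj [Fintype J] (S : LinSys I K J) (z p : EuclideanSpace ℝ J) : Prop :=
  S.A *ᵥ p.ofLp = S.b ∧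
    ∀ y : EuclideanSpace ℝ J, S.A *ᵥ y.ofLp = S.b → inner ℝ (z - p) (y - p) = 0

end LinSys

/-! ## The Elementary Procedure and the divide-and-conquer (D&C) algorithm -/

/-- Possible outcomes of D&C: an approximate solution, a hyperplane `h x = δ`, or failure. -/
inductive Outcome (E : Type) where
  | solution (x : E)
  | hyperplane (h : E) (δ : ℝ)
  | failure

section DC

variable {I K J : Type} [Fintype J]

/-- `EP S z r o`: the Elementary Procedure on the system `S`, with center `z` and radius `r`, can
return `o` (the violated inequality reported in the last case may be any of them). -/
inductive EP (S : LinSys I K J) (z : EuclideanSpace ℝ J) (r : ℝ) :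
    Outcome (EuclideanSpace ℝ J) → Prop where
  | solution (p : EuclideanSpace ℝ J) (hp : S.IsProj z p) (h₁ : ‖p - z‖ < r)
      (h₂ : ∀ k, ((S.C *ᵥ z.ofLp) k - S.d k) / ‖S.row k‖ < r) : EP S z r (.solution p)
  | affine (p : EuclideanSpace ℝ J) (hp : S.IsProj z p) (h₁ : r ≤ ‖p - z‖) :
      EP S z r (.hyperplane (z - p) (inner ℝ (z - p) p))
  | violated (p : EuclideanSpace ℝ J) (hp : S.IsProj z p) (h₁ : ‖p - z‖ < r) (k : K)
      (h₂ : r ≤ ((S.C *ᵥ z.ofLp) k - S.d k) / ‖S.row k‖) :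
      EP S z r (.hyperplane (S.row k) (S.d k))

/-- The parameter of the recursion: radii shrink by the factor `1 / (1 + θ) = 5 / 7`. -/
def theta : ℝ := 2 / 5

/-- A pending call of D&C with parameters `z, r`: it waits for the result of its first recursive
call, or for that of its second one, the first having returned `h₁ x = δ₁`. -/
inductive Frame (E : Type) where
  | first (z : E) (r : ℝ)
  | second (z : E) (r : ℝ) (h₁ : E) (δ₁ : ℝ)

/-- A configuration of a run of D&C: about to execute a call with parameters `z, r`, or about to
return an outcome, in both cases to the pending calls on the stack. -/
inductive DCState (E : Type) where
  | call (z : E) (r : ℝ) (stack : List (Frame E))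
  | ret (o : Outcome E) (stack : List (Frame E))

/-- The orthogonal projection of `z` onto the hyperplane `h x = δ`. -/
def projHyperplane (h : EuclideanSpace ℝ J) (δ : ℝ) (z : EuclideanSpace ℝ J) :
    EuclideanSpace ℝ J :=
  z - ((inner ℝ h z - δ) / inner ℝ h h) • h

/-- One step of the D&C algorithm on the system `S` with error bound `ε`. -/
inductive DCStep (S : LinSys I K J) (ε : ℝ) :
    DCState (EuclideanSpace ℝ J) → DCState (EuclideanSpace ℝ J) → Prop where
  /-- The radius is small: run the Elementary Procedure and return its result. -/
  | base (z r K o) (hr : r ≤ ε / (2 * S.normCmax)) (ho : EP S z r o) :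
      DCStep S ε (.call z r K) (.ret o K)
  /-- The radius is not small: first recursive call, with the same center. -/
  | recurse (z r K) (hr : ¬ r ≤ ε / (2 * S.normCmax)) :
      DCStep S ε (.call z r K) (.call z (r / (1 + theta)) (.first z r :: K))
  /-- A recursive call found a solution: return it. -/
  | found (x F K) : DCStep S ε (.ret (.solution x) (F :: K)) (.ret (.solution x) K)
  /-- A recursive call failed: the whole run fails. -/
  | failed (F K) : DCStep S ε (.ret .failure (F :: K)) (.ret .failure K)
  /-- The first recursive call returned `h₁ x = δ₁`: second recursive call, centered at the
  projection of `z` onto that hyperplane. -/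
  | project (z r h₁ δ₁ K) :
      DCStep S ε (.ret (.hyperplane h₁ δ₁) (.first z r :: K))
        (.call (projHyperplane h₁ δ₁ z) (r / (1 + theta)) (.second z r h₁ δ₁ :: K))
  /-- The second recursive call returned `h₂ x = δ₂` with `h₁ = -γ h₂`, `γ > 0`: fail. -/
  | opposite (z r h₁ δ₁ h₂ δ₂ K) (hop : ∃ γ : ℝ, 0 < γ ∧ h₁ = -(γ • h₂)) :
      DCStep S ε (.ret (.hyperplane h₂ δ₂) (.second z r h₁ δ₁ :: K)) (.ret .failure K)
  /-- Otherwise return any convex combination of the two hyperplanes that is at distance at least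
  `r` from `z`. (For `r > 0` the last condition forces the combination to have a nonzero normal
  vector.) -/
  | combine (z r h₁ δ₁ h₂ δ₂ K) (α : ℝ) (hop : ¬ ∃ γ : ℝ, 0 < γ ∧ h₁ = -(γ • h₂))
      (hα₀ : 0 ≤ α) (hα₁ : α ≤ 1)
      (hα : r ≤ (inner ℝ (α • h₁ + (1 - α) • h₂) z - (α * δ₁ + (1 - α) * δ₂)) /
        ‖α • h₁ + (1 - α) • h₂‖) :
      DCStep S ε (.ret (.hyperplane h₂ δ₂) (.second z r h₁ δ₁ :: K))
        (.ret (.hyperplane (α • h₁ + (1 - α) • h₂) (α * δ₁ + (1 - α) * δ₂)) K)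

end DC

/-! ## Sizes, facet complexity and the radius -/

/-- The size of a rational number `p / q` (in lowest terms):
`1 + ⌈log₂ (|p| + 1)⌉ + ⌈log₂ (q + 1)⌉`. -/
def ratSize (q : ℚ) : ℕ := 1 + Nat.clog 2 (q.num.natAbs + 1) + Nat.clog 2 (q.den + 1)

/-- The size of the inequality `a x ≤ β`: `1 + size a + size β`, where the size of a vector is the
number of its entries plus the sum of their sizes. -/
def ineqSize {J : Type} [Fintype J] (a : J → ℚ) (β : ℚ) : ℕ :=
  1 + (Fintype.card J + ∑ j, ratSize (a j)) + ratSize β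

/-- The facet complexity of a rational polyhedron `P`: the least `φ`, at least the dimension of the
space, such that `P` is the solution set of a finite system of rational linear inequalities each of
size at most `φ`. -/
def facetComplexity {J : Type} [Fintype J] (P : Set (J → ℝ)) : ℕ :=
  sInf {φ : ℕ | Fintype.card J ≤ φ ∧ ∃ (N : ℕ) (M : Matrix (Fin N) J ℚ) (β : Fin N → ℚ),
    P = {x | ∀ i, ∑ j, (M i j : ℝ) * x j ≤ (β i : ℝ)} ∧ ∀ i, ineqSize (M i) (β i) ≤ φ}

/-- Schrijver's radius `2 ^ (5 N² φ) √N`, where `N` is the dimension and `φ` the facet complexity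
of the polyhedron `P`. -/
def schrijverRadius {J : Type} [Fintype J] (P : Set (J → ℝ)) : ℝ :=
  2 ^ (5 * Fintype.card J ^ 2 * facetComplexity P) * Real.sqrt (Fintype.card J)

/-! ## The LFG algorithm -/

/-- Integer input data `A, b, C, d` with `m` equations, `l` inequalities and `n` variables. -/
structure Input (m l n : ℕ) where
  A : Matrix (Fin m) (Fin n) ℤ
  b : Fin m → ℤ
  C : Matrix (Fin l) (Fin n) ℤ
  d : Fin l → ℤ

/-- The number of bits of an integer: a sign bit and `⌈log₂ (|a| + 1)⌉` binary digits. -/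
def intBits (a : ℤ) : ℕ := 1 + Nat.clog 2 (a.natAbs + 1)

namespace Input

variable {m l n : ℕ}

/-- The system `A x = b`, `C x ≤ d` over the reals. -/
def toSys (D : Input m l n) : LinSys (Fin m) (Fin l) (Fin n) where
  A := D.A.map (fun a : ℤ => (a : ℝ))
  b := fun i => (D.b i : ℝ)
  C := D.C.map (fun a : ℤ => (a : ℝ))
  d := fun k => (D.d k : ℝ)

/-- The bit length `T` of the input data. -/
def bitLength (D : Input m l n) : ℕ :=
  (∑ i, ∑ j, intBits (D.A i j)) + (∑ i, intBits (D.b i)) +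
    (∑ k, ∑ j, intBits (D.C k j)) + ∑ k, intBits (D.d k)

/-- `ν = 2 ^ (-2T)`. -/
def nu (D : Input m l n) : ℝ := ((2 : ℝ) ^ (2 * D.bitLength))⁻¹

/-- The system handed to D&C, in the variables `(x, t)`: `A x - b t = 0`,
`C x - (d + ν/2) t ≤ -1`, `-t ≤ -2`. -/
def dcSys (D : Input m l n) : LinSys (Fin m) (Fin l ⊕ Unit) (Fin n ⊕ Unit) :=
  ((D.toSys.relax (D.nu / 2)).parameterize).strengthen 1

/-- The radius handed to D&C. -/
def radius (D : Input m l n) : ℝ := schrijverRadius {y | D.dcSys.Feasible y}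

/-- `L_x`, the indices `k` with `d_k ≤ c_k x < d_k + ν`. -/
def active (D : Input m l n) (x : Fin n → ℝ) : Set (Fin l) :=
  {k | D.toSys.d k ≤ (D.toSys.C *ᵥ x) k ∧ (D.toSys.C *ᵥ x) k < D.toSys.d k + D.nu}

/-- The linear span of the rows `a_i`, `i ∈ I'`, and `c_k`, `k ∈ L'`. -/
def rowSpan (D : Input m l n) (I' : Set (Fin m)) (L' : Set (Fin l)) : Submodule ℝ (Fin n → ℝ) :=
  Submodule.span ℝ (D.toSys.A '' I' ∪ D.toSys.C '' L')

end Input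

/-- A configuration of a run of the LFG algorithm. -/
inductive State (n : ℕ) where
  | start
  | dc (s : DCState (EuclideanSpace ℝ (Fin n ⊕ Unit)))
  | rounding (x : Fin n → ℝ)
  | feasible (x : Fin n → ℝ)
  | infeasible

/-- One step of the LFG algorithm on the input `D`. -/
inductive Step {m l n : ℕ} (D : Input m l n) : State n → State n → Prop where
  /-- Set up the strengthened parameterized system and call D&C with `z = 0` and the radius. -/
  | init : Step D .start (.dc (.call 0 D.radius []))
  /-- One step of D&C, with `ε = 1`. -/
  | dc (s s') (hs : DCStep D.dcSys 1 s s') : Step D (.dc s) (.dc s')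
  /-- D&C found `(x, t)`: round `x / t` to an exact solution. -/
  | found (y : EuclideanSpace ℝ (Fin n ⊕ Unit)) :
      Step D (.dc (.ret (.solution y) []))
        (.rounding fun j => y.ofLp (.inl j) / y.ofLp (.inr ()))
  /-- D&C returned a hyperplane: declare infeasibility. -/
  | separated (h δ) : Step D (.dc (.ret (.hyperplane h δ) [])) .infeasible
  /-- D&C failed: declare infeasibility. -/
  | failed : Step D (.dc (.ret .failure [])) .infeasible
  /-- Rounding, main loop. Some `c_k`, `k ∉ L_x`, is not a linear combination of the `a_i` and of
  the `c_j`, `j ∈ L_x`: take a direction `w` with `a_i w = 0`, `c_j w = 0` for `j ∈ L_x` and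
  `c_k w = 1`, and move along `w` until the first inequality outside `L_x` becomes tight. -/
  | move (x w : Fin n → ℝ) (k j : Fin l)
      (hk : k ∉ D.active x) (hspan : D.toSys.C k ∉ D.rowSpan Set.univ (D.active x))
      (hwA : D.toSys.A *ᵥ w = 0) (hwL : ∀ i ∈ D.active x, (D.toSys.C *ᵥ w) i = 0)
      (hwk : (D.toSys.C *ᵥ w) k = 1)
      (hj : j ∉ D.active x) (hwj : 0 < (D.toSys.C *ᵥ w) j)
      (hmin : ∀ i, i ∉ D.active x → 0 < (D.toSys.C *ᵥ w) i →
        (D.toSys.d j - (D.toSys.C *ᵥ x) j) / (D.toSys.C *ᵥ w) j ≤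
          (D.toSys.d i - (D.toSys.C *ᵥ x) i) / (D.toSys.C *ᵥ w) i) :
      Step D (.rounding x)
        (.rounding (x + ((D.toSys.d j - (D.toSys.C *ᵥ x) j) / (D.toSys.C *ᵥ w) j) • w))
  /-- Rounding, exit. Every `c_k` is a linear combination of the `a_i` and of the `c_j`, `j ∈ L_x`:
  take a maximal linearly independent family consisting of rows `a_i`, `i ∈ I'`, that span all rows
  of `A`, and of rows `c_j`, `j ∈ L' ⊆ L_x`, and return a solution `y` of the equations
  `a_i y = b_i` (`i ∈ I'`), `c_j y = d_j` (`j ∈ L'`). -/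
  | finish (x y : Fin n → ℝ) (I' : Set (Fin m)) (L' : Set (Fin l))
      (hspan : ∀ k, k ∉ D.active x → D.toSys.C k ∈ D.rowSpan Set.univ (D.active x))
      (hL : L' ⊆ D.active x)
      (hindep : LinearIndependent ℝ
        (Sum.elim (fun i : I' => D.toSys.A i) (fun k : L' => D.toSys.C k)))
      (hI : D.rowSpan I' ∅ = D.rowSpan Set.univ ∅)
      (hmax : D.rowSpan I' L' = D.rowSpan Set.univ (D.active x))
      (hyA : ∀ i ∈ I', (D.toSys.A *ᵥ y) i = D.toSys.b i)
      (hyL : ∀ k ∈ L', (D.toSys.C *ᵥ y) k = D.toSys.d k) :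
      Step D (.rounding x) (.feasible y)

/-- `StepsTo D N s`: some execution of the LFG algorithm on `D` is in configuration `s` after
exactly `N` steps. -/
inductive StepsTo {m l n : ℕ} (D : Input m l n) : ℕ → State n → Prop where
  | zero : StepsTo D 0 .start
  | succ (N s s') (h : StepsTo D N s) (hs : Step D s s') : StepsTo D (N + 1) s'

end LFG

end

/-!
Every call of D&C at `(z, r)` either finds a point solving the system up to `ε`, or a valid
inequality violated at `z` by a distance of at least `r`, or proves infeasibility. The second
recursive call starts on the hyperplane found by the first. In the plane of the two normals the
violations are then the values of a linear functional at two unit vectors, one of which is corrected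
to an orthogonal direction; unless the normals are opposite, some conic combination of them is
violated by `√2` times the radius of the recursive calls, and `√2 > 7 / 5 = 1 + θ`.

If (1) has a solution, scaling it by `t = 2 / ν` solves the strengthened homogeneous system, which
by Cramer's rule then has a point in the ball of radius `r` about `0`. No valid inequality is
violated at `0` by a distance of `r` in that case, so that a hyperplane at the top level proves
infeasibility.

Rounding enlarges `L_x` in every step. At its end Cramer's rule writes `Δ c_k`, for some integer
`Δ > 0`, as an integral combination of the selected rows with coefficients so small compared to
`1 / ν` that the integer `Δ (c_k x̂ - d_k)` is less than `1`, hence not positive.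
-/

namespace LFG

/-! ## Determinants and integer linear systems -/

section IntegerSystems

variable {ι J : Type*} [Fintype ι]

theorem sum_comp_le_sum_of_injective [Fintype J] {M : Type*} [AddCommMonoid M] [PartialOrder M]
    [IsOrderedAddMonoid M] {e : ι → J} (he : Function.Injective e) {f : J → M}
    (hf : ∀ j, 0 ≤ f j) : ∑ i, f (e i) ≤ ∑ j, f j := by
  classical
  rw [← Finset.sum_image (f := f) he.injOn]
  exact Finset.sum_le_sum_of_subset_of_nonneg (Finset.subset_univ _) fun j _ _ => hf j

theorem abs_det_le_prod_sum_abs {R : Type*} [CommRing R] [LinearOrder R] [IsStrictOrderedRing R]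
    [DecidableEq ι] (M : Matrix ι ι R) : |M.det| ≤ ∏ i, ∑ j, |M i j| := by
  have habs (σ : Equiv.Perm ι) : |σ.sign • ∏ i, Mᵀ (σ i) i| = ∏ i, |M i (σ i)| := by
    rcases Int.units_eq_one_or σ.sign with h | h <;> simp [h, Finset.abs_prod]
  calc |M.det| = |∑ σ : Equiv.Perm ι, σ.sign • ∏ i, Mᵀ (σ i) i| := by
        rw [← Matrix.det_transpose, Matrix.det_apply]
    _ ≤ ∑ σ : Equiv.Perm ι, ∏ i, |M i (σ i)| := by
        simpa only [habs] using Finset.abs_sum_le_sum_abs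
          (fun σ : Equiv.Perm ι => σ.sign • ∏ i, Mᵀ (σ i) i) Finset.univ
    _ ≤ ∑ f : ι → ι, ∏ i, |M i (f i)| :=
        sum_comp_le_sum_of_injective (e := fun (σ : Equiv.Perm ι) i => σ i)
          (f := fun f => ∏ i, |M i (f i)|) (fun _ _ h => Equiv.ext (congrFun h))
          fun _ => Finset.prod_nonneg fun _ _ => abs_nonneg _
    _ = ∏ i, ∑ j, |M i j| := by rw [Finset.prod_univ_sum, Fintype.piFinset_univ]

theorem exists_submatrix_det_ne_zero [Finite J] {R 𝕜 : Type*} [CommRing R] [Field 𝕜]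
    [DecidableEq ι] (f : R →+* 𝕜) (M : Matrix ι J R) (hM : LinearIndependent 𝕜 (M.map f).row) :
    ∃ e : ι → J, Function.Injective e ∧ (M.submatrix id e).det ≠ 0 := by
  have := Fintype.ofFinite J
  obtain ⟨κ, a, ha, hspan, hli⟩ := exists_linearIndependent' 𝕜 (M.map f).col
  have : Finite κ := Finite.of_injective a ha
  have := Fintype.ofFinite κ
  have hcard : Fintype.card κ = Fintype.card ι := by
    rw [linearIndependent_iff_card_eq_finrank_span.mp hli, Set.finrank, hspan,
      ← Matrix.rank_eq_finrank_span_cols, LinearIndependent.rank_matrix hM]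
  let g : ι ≃ κ := Fintype.equivOfCardEq hcard.symm
  have hcol : LinearIndependent 𝕜 ((M.map f).submatrix id (a ∘ g)).col := hli.comp g g.injective
  rw [Matrix.linearIndependent_cols_iff_isUnit, Matrix.isUnit_iff_isUnit_det,
    Matrix.submatrix_map, ← RingHom.mapMatrix_apply, ← RingHom.map_det] at hcol
  exact ⟨a ∘ g, ha.comp g.injective, fun h => hcol.ne_zero (by rw [h, map_zero])⟩

theorem cramer_transpose_vecMul {R : Type*} [CommRing R] [DecidableEq ι] (M : Matrix ι ι R)
    (c : ι → R) : Mᵀ.cramer (c ᵥ* M) = M.det • c := by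
  rw [Matrix.cramer_eq_adjugate_mulVec, ← Matrix.adjugate_transpose, Matrix.mulVec_transpose,
    Matrix.vecMul_vecMul, Matrix.mul_adjugate, Matrix.vecMul_smul, Matrix.vecMul_one]

theorem abs_cramer_transpose_le [DecidableEq ι] (M : Matrix ι ι ℤ) (b : ι → ℤ) (i : ι) :
    |Mᵀ.cramer b i| ≤ (1 + ∑ j, |b j|) * ∏ i, (1 + ∑ j, |M i j|) := by
  have hnonneg (x : ι → ℤ) : 0 ≤ ∑ j, |x j| := Finset.sum_nonneg fun _ _ => abs_nonneg _
  rw [Matrix.cramer_transpose_apply]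
  refine (abs_det_le_prod_sum_abs _).trans ?_
  rw [← Finset.mul_prod_erase _ _ (Finset.mem_univ i), Matrix.updateRow_self]
  refine mul_le_mul (by linarith) ?_ (Finset.prod_nonneg fun i _ => hnonneg _)
    (by linarith [hnonneg b])
  calc ∏ i' ∈ Finset.univ.erase i, ∑ j, |M.updateRow i b i' j|
      ≤ ∏ i' ∈ Finset.univ.erase i, (1 + ∑ j, |M i' j|) := by
        refine Finset.prod_le_prod (fun i' _ => hnonneg _) fun i' hi' => ?_
        rw [Matrix.updateRow_ne (Finset.ne_of_mem_erase hi')]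
        linarith
    _ ≤ ∏ i, (1 + ∑ j, |M i j|) :=
        Finset.prod_le_prod_of_subset_of_one_le (Finset.subset_univ _)
          (fun i' _ => by linarith [hnonneg (M i')]) fun i' _ _ => by linarith [hnonneg (M i')]

theorem det_smul_eq_sum_cramer {R 𝕜 : Type*} [CommRing R] [Field 𝕜] [DecidableEq ι]
    {f : R →+* 𝕜} (hf : Function.Injective f) {v : ι → J → R} {u : J → R}
    (hu : f ∘ u ∈ Submodule.span 𝕜 (Set.range fun i => f ∘ v i)) (e : ι → J) :
    ((Matrix.of v).submatrix id e).det • u =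
      ∑ i, ((Matrix.of v).submatrix id e)ᵀ.cramer (u ∘ e) i • v i := by
  obtain ⟨c, hc⟩ := (Submodule.mem_span_range_iff_exists_fun 𝕜).mp hu
  set M : Matrix ι ι R := (Matrix.of v).submatrix id e
  have hcj (j : J) : ∑ i, c i * f (v i j) = f (u j) := by simpa using congrFun hc j
  have hcramer (i : ι) : f (Mᵀ.cramer (u ∘ e) i) = f M.det * c i := by
    have hvec : c ᵥ* M.map f = f ∘ (u ∘ e) := funext fun k => hcj (e k)
    rw [Matrix.cramer_eq_adjugate_mulVec, RingHom.map_mulVec, ← RingHom.mapMatrix_apply,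
      RingHom.map_adjugate, RingHom.mapMatrix_apply, Matrix.transpose_map,
      ← Matrix.cramer_eq_adjugate_mulVec, ← hvec, cramer_transpose_vecMul,
      ← RingHom.mapMatrix_apply, ← RingHom.map_det, Pi.smul_apply, smul_eq_mul]
  ext j
  apply hf
  simp only [Pi.smul_apply, Finset.sum_apply, smul_eq_mul, map_mul, map_sum, hcramer, ← hcj,
    mul_assoc, Finset.mul_sum]

/-- By Cramer's rule the coefficients are quotients of minors of `v` bordered by `u`, with a common
denominator. -/
theorem exists_pos_int_relation [Fintype J] (𝕜 : Type*) [Field 𝕜] [CharZero 𝕜] {v : ι → J → ℤ}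
    (hv : LinearIndependent 𝕜 fun i j => (v i j : 𝕜)) {u : J → ℤ}
    (hu : (fun j => (u j : 𝕜)) ∈ Submodule.span 𝕜 (Set.range fun i j => (v i j : 𝕜))) :
    ∃ (Δ : ℤ) (μ : ι → ℤ), 0 < Δ ∧ Δ • u = ∑ i, μ i • v i ∧ Δ ≤ ∏ i, (1 + ∑ j, |v i j|) ∧
      ∀ i, |μ i| ≤ (1 + ∑ j, |u j|) * ∏ i, (1 + ∑ j, |v i j|) := by
  classical
  obtain ⟨e, he, hdet⟩ := exists_submatrix_det_ne_zero (Int.castRingHom 𝕜) (Matrix.of v) hv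
  set M : Matrix ι ι ℤ := (Matrix.of v).submatrix id e
  set c : ι → ℤ := Mᵀ.cramer (u ∘ e)
  have hrel : M.det • u = ∑ i, c i • v i :=
    det_smul_eq_sum_cramer (f := Int.castRingHom 𝕜) Int.cast_injective hu e
  have hnonneg (x : ι → ℤ) : 0 ≤ ∑ k, |x k| := Finset.sum_nonneg fun _ _ => abs_nonneg _
  have hrow (x : J → ℤ) : 1 + ∑ k, |x (e k)| ≤ 1 + ∑ j, |x j| :=
    add_le_add_right (sum_comp_le_sum_of_injective he (f := fun j => |x j|)
      fun j => abs_nonneg _) 1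
  have hprod : ∏ i, (1 + ∑ k, |M i k|) ≤ ∏ i, (1 + ∑ j, |v i j|) :=
    Finset.prod_le_prod (fun i _ => add_nonneg zero_le_one (hnonneg _)) fun i _ => hrow (v i)
  refine ⟨|M.det|, fun i => M.det.sign * c i, abs_pos.mpr hdet, ?_, ?_, fun i => ?_⟩
  · simp only [← Int.sign_mul_self_eq_abs, mul_smul, hrel, Finset.smul_sum]
  · exact (abs_det_le_prod_sum_abs M).trans <| (Finset.prod_le_prod (fun i _ => hnonneg _)
      fun i _ => le_add_of_nonneg_left zero_le_one).trans hprod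
  · calc |M.det.sign * c i| ≤ |c i| := by
          rw [abs_mul]
          exact mul_le_of_le_one_left (abs_nonneg _) (Int.abs_sign_of_ne_zero hdet).le
      _ ≤ (1 + ∑ k, |u (e k)|) * ∏ i, (1 + ∑ k, |M i k|) := abs_cramer_transpose_le M (u ∘ e) i
      _ ≤ (1 + ∑ j, |u j|) * ∏ i, (1 + ∑ j, |v i j|) :=
          mul_le_mul (hrow u) hprod
            (Finset.prod_nonneg fun i _ => add_nonneg zero_le_one (hnonneg _))
            ((add_nonneg zero_le_one (hnonneg _)).trans (hrow u))

theorem abs_cramer_le [DecidableEq ι] (M : Matrix ι ι ℤ) (β : ι → ℤ) (k : ι) :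
    |M.cramer β k| ≤ ∏ i, (∑ j, |M i j| + |β i|) := by
  rw [Matrix.cramer_apply]
  refine (abs_det_le_prod_sum_abs _).trans (Finset.prod_le_prod
    (fun i _ => Finset.sum_nonneg fun _ _ => abs_nonneg _) fun i _ => ?_)
  calc ∑ j, |M.updateCol k β i j| = ∑ j ∈ Finset.univ.erase k, |M i j| + |β i| := by
        rw [← Finset.sum_erase_add _ _ (Finset.mem_univ k), Matrix.updateCol_self,
          Finset.sum_congr rfl fun j hj => by rw [Matrix.updateCol_ne (Finset.ne_of_mem_erase hj)]]
    _ ≤ ∑ j, |M i j| + |β i| := by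
        gcongr
        exact Finset.subset_univ _

theorem exists_solution_abs_le [Fintype J] (𝕜 : Type*) [Field 𝕜] [LinearOrder 𝕜]
    [IsStrictOrderedRing 𝕜] {v : ι → J → ℤ} (hv : LinearIndependent 𝕜 fun i j => (v i j : 𝕜))
    (β : ι → ℤ) :
    ∃ y : J → 𝕜, (∀ i, ∑ j, (v i j : 𝕜) * y j = β i) ∧
      ∀ j, |y j| ≤ ((∏ i, (∑ j, |v i j| + |β i|) : ℤ) : 𝕜) := by
  classical
  obtain ⟨e, he, hdet⟩ := exists_submatrix_det_ne_zero (Int.castRingHom 𝕜) (Matrix.of v) hv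
  set M : Matrix ι ι ℤ := (Matrix.of v).submatrix id e
  have hdet' : (M.det : 𝕜) ≠ 0 := Int.cast_ne_zero.mpr hdet
  have hnonneg (x : J → ℤ) : 0 ≤ ∑ j, |x j| := Finset.sum_nonneg fun _ _ => abs_nonneg _
  refine ⟨Function.extend e (fun k => (M.cramer β k : 𝕜) / M.det) 0, fun i => ?_, fun j => ?_⟩
  · have hcramer : ∑ k, (v i (e k) : 𝕜) * M.cramer β k = M.det * β i := mod_cast
      congrFun (Matrix.mulVec_cramer M β) i
    rw [← Finset.sum_subset (Finset.subset_univ (Finset.univ.image e)) fun j _ hj => ?_,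
      Finset.sum_image he.injOn]
    · simp only [he.extend_apply, ← mul_div_assoc, ← Finset.sum_div, hcramer]
      exact mul_div_cancel_left₀ _ hdet'
    · rw [Function.extend_apply' _ _ _ (by simpa using hj), Pi.zero_apply, mul_zero]
  · by_cases hj : ∃ k, e k = j
    · obtain ⟨k, rfl⟩ := hj
      rw [he.extend_apply, abs_div]
      refine (div_le_self (abs_nonneg _) (mod_cast Int.one_le_abs hdet)).trans ?_
      norm_cast
      refine (abs_cramer_le M β k).trans (Finset.prod_le_prod (fun i _ =>
        add_nonneg (Finset.sum_nonneg fun _ _ => abs_nonneg _) (abs_nonneg _)) fun i _ => ?_)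
      exact add_le_add_left (sum_comp_le_sum_of_injective he (f := fun j => |v i j|)
        fun j => abs_nonneg _) _
    · rw [Function.extend_apply' _ _ _ hj, Pi.zero_apply, abs_zero]
      exact Int.cast_nonneg (Finset.prod_nonneg fun i _ => add_nonneg (hnonneg _) (abs_nonneg _))

end IntegerSystems

/-! ## Spans of rows and tight rows -/

section TightRows

variable {J : Type*} [Fintype J]

theorem exists_dotProduct_eq_one {𝕜 : Type*} [Field 𝕜] {s : Set (J → 𝕜)} {u : J → 𝕜}
    (hu : u ∉ Submodule.span 𝕜 s) : ∃ w : J → 𝕜, (∀ a ∈ s, a ⬝ᵥ w = 0) ∧ u ⬝ᵥ w = 1 := by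
  classical
  obtain ⟨f, hfu, hf⟩ := Submodule.exists_le_ker_of_notMem hu
  have hrep (a : J → 𝕜) : a ⬝ᵥ (dotProductEquiv 𝕜 J).symm f = f a := by
    rw [dotProduct_comm, ← dotProductEquiv_apply_apply, LinearEquiv.apply_symm_apply]
  refine ⟨(f u)⁻¹ • (dotProductEquiv 𝕜 J).symm f, fun a ha => ?_, ?_⟩
  · rw [dotProduct_smul, hrep, LinearMap.mem_ker.mp (hf (Submodule.subset_span ha)), smul_zero]
  · rw [dotProduct_smul, hrep, smul_eq_mul, inv_mul_cancel₀ hfu]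

theorem dotProduct_eq_of_mem_span {R : Type*} [CommSemiring R] {s : Set (J → R)} {x y u : J → R}
    (hs : ∀ a ∈ s, a ⬝ᵥ x = a ⬝ᵥ y) (hu : u ∈ Submodule.span R s) : u ⬝ᵥ x = u ⬝ᵥ y := by
  induction hu using Submodule.span_induction with
  | mem u hu => exact hs u hu
  | zero => simp only [zero_dotProduct]
  | add u v _ _ hu hv => rw [add_dotProduct, add_dotProduct, hu, hv]
  | smul a u _ hu => rw [smul_dotProduct, smul_dotProduct, hu]

theorem ratio_mul_le {𝕜 : Type*} [Field 𝕜] [LinearOrder 𝕜] [IsStrictOrderedRing 𝕜]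
    {s t g h : 𝕜} (hs : 0 ≤ s) (ht : 0 ≤ t) (hg : 0 < g) (hmin : 0 < h → s / g ≤ t / h) :
    s / g * h ≤ t := by
  rcases lt_or_ge 0 h with hh | hh
  · exact (le_div_iff₀ hh).mp (hmin hh)
  · exact (mul_nonpos_of_nonneg_of_nonpos (div_nonneg hs hg.le) hh).trans ht

/-- Take a feasible point with a maximal set of tight rows: if some row were not in their span, one
could move in a direction along which all tight rows stay tight until another row becomes tight. -/
theorem exists_tight_span {𝕜 ι : Type*} [Field 𝕜] [LinearOrder 𝕜] [IsStrictOrderedRing 𝕜]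
    [Finite ι] {M : ι → J → 𝕜} {β : ι → 𝕜} (hP : ∃ x, ∀ i, M i ⬝ᵥ x ≤ β i) :
    ∃ x, (∀ i, M i ⬝ᵥ x ≤ β i) ∧ ∀ k, M k ∈ Submodule.span 𝕜 (M '' {i | M i ⬝ᵥ x = β i}) := by
  obtain ⟨x, hx, hmax⟩ := (Set.toFinite ((fun x => {i | M i ⬝ᵥ x = β i}) ''
    {x | ∀ i, M i ⬝ᵥ x ≤ β i})).exists_maximalFor' (fun x => {i | M i ⬝ᵥ x = β i}) _ hP
  refine ⟨x, hx, fun k => ?_⟩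
  by_contra hk
  obtain ⟨w, hw, hwk⟩ := exists_dotProduct_eq_one hk
  obtain ⟨j, hj : 0 < M j ⬝ᵥ w, hmin⟩ := Set.exists_min_image {i | 0 < M i ⬝ᵥ w}
    (fun i => (β i - M i ⬝ᵥ x) / (M i ⬝ᵥ w)) (Set.toFinite _) ⟨k, by simp [hwk]⟩
  set t := (β j - M j ⬝ᵥ x) / (M j ⬝ᵥ w) with ht
  have hmove (i : ι) : M i ⬝ᵥ (x + t • w) = M i ⬝ᵥ x + t * (M i ⬝ᵥ w) := by
    rw [dotProduct_add, dotProduct_smul, smul_eq_mul]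
  have hfeas (i : ι) : M i ⬝ᵥ (x + t • w) ≤ β i := by
    rw [hmove, ← le_sub_iff_add_le']
    exact ratio_mul_le (sub_nonneg.mpr (hx j)) (sub_nonneg.mpr (hx i)) hj (hmin i)
  have htight : {i | M i ⬝ᵥ x = β i} ⊆ {i | M i ⬝ᵥ (x + t • w) = β i} := fun i hi => by
    rw [Set.mem_ofPred_eq, hmove, hw _ ⟨i, hi, rfl⟩, mul_zero, add_zero]
    exact hi
  have hjtight : M j ⬝ᵥ (x + t • w) = β j := by
    rw [hmove, ht, div_mul_cancel₀ _ hj.ne', add_sub_cancel]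
  exact hj.ne' (hw _ ⟨j, hmax hfeas htight hjtight, rfl⟩)

end TightRows

/-! ## Combining two separating hyperplanes -/

section Geometry

variable {E : Type*} [NormedAddCommGroup E] [InnerProductSpace ℝ E]

theorem norm_smul_add_smul_sq_of_inner_eq_zero {u v : E} (huv : inner ℝ u v = 0) (p q : ℝ) :
    ‖p • u + q • v‖ ^ 2 = p ^ 2 * ‖u‖ ^ 2 + q ^ 2 * ‖v‖ ^ 2 := by
  rw [norm_add_sq_real, inner_smul_left, inner_smul_right, huv, norm_smul, norm_smul, mul_pow,
    mul_pow, Real.norm_eq_abs, Real.norm_eq_abs, sq_abs, sq_abs]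
  ring

theorem sqrt_two_mul_mul_le {ρ N V : ℝ} (hV : 0 ≤ V) (h : 2 * (ρ ^ 2 * N ^ 2) ≤ V ^ 2) :
    √2 * ρ * N ≤ V := by
  refine (abs_le_of_sq_le_sq' ?_ hV).2
  rwa [mul_pow, mul_pow, Real.sq_sqrt zero_le_two, mul_assoc]

theorem sqrt_two_mul_norm_le_of_inner_eq_zero {u w : E} {ρ s t : ℝ} (huw : inner ℝ u w = 0)
    (hρ : 0 ≤ ρ) (hs : ρ * ‖u‖ ≤ s) (ht : ρ * ‖w‖ ≤ t) :
    √2 * ρ * ‖(s * ‖w‖ ^ 2) • u + (t * ‖u‖ ^ 2) • w‖ ≤ s ^ 2 * ‖w‖ ^ 2 + t ^ 2 * ‖u‖ ^ 2 := by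
  refine sqrt_two_mul_mul_le (by positivity) ?_
  have hs₂ : ρ ^ 2 * ‖u‖ ^ 2 ≤ s ^ 2 := by rw [← mul_pow]; gcongr
  have ht₂ : ρ ^ 2 * ‖w‖ ^ 2 ≤ t ^ 2 := by rw [← mul_pow]; gcongr
  calc 2 * (ρ ^ 2 * ‖(s * ‖w‖ ^ 2) • u + (t * ‖u‖ ^ 2) • w‖ ^ 2)
      = (ρ ^ 2 * ‖u‖ ^ 2 * ‖w‖ ^ 2 + ρ ^ 2 * ‖w‖ ^ 2 * ‖u‖ ^ 2) *
          (s ^ 2 * ‖w‖ ^ 2 + t ^ 2 * ‖u‖ ^ 2) := by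
        rw [norm_smul_add_smul_sq_of_inner_eq_zero huw]
        ring
    _ ≤ (s ^ 2 * ‖w‖ ^ 2 + t ^ 2 * ‖u‖ ^ 2) * (s ^ 2 * ‖w‖ ^ 2 + t ^ 2 * ‖u‖ ^ 2) := by gcongr
    _ = (s ^ 2 * ‖w‖ ^ 2 + t ^ 2 * ‖u‖ ^ 2) ^ 2 := (sq _).symm

theorem sqrt_two_mul_norm_le_of_ratio_le {u w : E} {β ρ s t : ℝ} (huw : inner ℝ u w = 0)
    (hu : u ≠ 0) (hρ : 0 ≤ ρ) (hβ : 0 ≤ β) (hs : ρ * ‖u‖ ≤ s) (ht : ρ * ‖β • u + w‖ ≤ t)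
    (hratio : s * ‖w‖ ^ 2 ≤ β * (t * ‖u‖ ^ 2)) : √2 * ρ * ‖β • u + w‖ ≤ t + β * s := by
  have hs₀ : 0 ≤ s := le_trans (by positivity) hs
  have ht₀ : 0 ≤ t := le_trans (by positivity) ht
  have hs₂ : ρ ^ 2 * ‖u‖ ^ 2 ≤ s ^ 2 := by rw [← mul_pow]; gcongr
  have ht₂ : ρ ^ 2 * ‖β • u + w‖ ^ 2 ≤ t ^ 2 := by rw [← mul_pow]; gcongr
  have hnorm : ‖β • u + w‖ ^ 2 = β ^ 2 * ‖u‖ ^ 2 + ‖w‖ ^ 2 := by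
    simpa using norm_smul_add_smul_sq_of_inner_eq_zero huw β 1
  have hmixed : ρ ^ 2 * ‖w‖ ^ 2 ≤ β * s * t := by
    refine le_of_mul_le_mul_right ?_ (by positivity : 0 < ‖u‖ ^ 2)
    calc ρ ^ 2 * ‖w‖ ^ 2 * ‖u‖ ^ 2 = ρ ^ 2 * ‖u‖ ^ 2 * ‖w‖ ^ 2 := by ring
      _ ≤ s ^ 2 * ‖w‖ ^ 2 := by gcongr
      _ = s * (s * ‖w‖ ^ 2) := by ring
      _ ≤ s * (β * (t * ‖u‖ ^ 2)) := by gcongr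
      _ = β * s * t * ‖u‖ ^ 2 := by ring
  refine sqrt_two_mul_mul_le (by positivity) ?_
  calc 2 * (ρ ^ 2 * ‖β • u + w‖ ^ 2)
      = ρ ^ 2 * ‖β • u + w‖ ^ 2 + (β ^ 2 * (ρ ^ 2 * ‖u‖ ^ 2) + ρ ^ 2 * ‖w‖ ^ 2) := by
        rw [hnorm]
        ring
    _ ≤ t ^ 2 + (β ^ 2 * s ^ 2 + β * s * t) := by gcongr
    _ ≤ t ^ 2 + (β ^ 2 * s ^ 2 + 2 * (β * s * t)) := by
        have : 0 ≤ β * s * t := by positivity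
        linarith
    _ = (t + β * s) ^ 2 := by ring

/-- In the orthogonal coordinates given by `u` and `w` the violations `s` and `t` are the values of
a linear functional. Its maximum over unit normals is attained at its Riesz representative; if that
lies outside the cone of `u` and `β • u + w`, then `β • u + w` itself is good enough. -/
theorem exists_conic_combination_of_inner_eq_zero {u w : E} {β ρ s t : ℝ} (huw : inner ℝ u w = 0)
    (hu : u ≠ 0) (hv : β • u + w ≠ 0) (hop : ¬ ∃ γ : ℝ, 0 < γ ∧ u = -(γ • (β • u + w)))
    (hρ : 0 < ρ) (hs : ρ * ‖u‖ ≤ s) (ht : ρ * ‖β • u + w‖ ≤ t) :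
    ∃ x y : ℝ, 0 ≤ x ∧ 0 ≤ y ∧ x • u + y • (β • u + w) ≠ 0 ∧
      √2 * ρ * ‖x • u + y • (β • u + w)‖ ≤ x * s + y * (t + β * s) := by
  have hs₀ : 0 < s := lt_of_lt_of_le (by positivity) hs
  have ht₀ : 0 < t := lt_of_lt_of_le (by positivity) ht
  rcases le_or_gt (β * (t * ‖u‖ ^ 2)) (s * ‖w‖ ^ 2) with hcone | hcone
  · have hw : w ≠ 0 := by
      rintro rfl
      rw [add_zero] at hv hop
      have hβ : β < 0 := (ne_of_apply_ne (· • u) (by simpa using hv)).lt_of_le <|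
        nonpos_of_mul_nonpos_left (by simpa using hcone) (by positivity)
      exact hop ⟨-β⁻¹, by simpa using hβ, by rw [neg_smul, neg_neg, inv_smul_smul₀ hβ.ne]⟩
    have hsum : (s * ‖w‖ ^ 2 - β * (t * ‖u‖ ^ 2)) • u + (t * ‖u‖ ^ 2) • (β • u + w) =
        (s * ‖w‖ ^ 2) • u + (t * ‖u‖ ^ 2) • w := by module
    have hnorm := norm_smul_add_smul_sq_of_inner_eq_zero huw
    have hwv : ‖w‖ ≤ ‖β • u + w‖ := le_of_sq_le_sq (by
      simpa using (le_add_of_nonneg_left (by positivity)).trans_eq (hnorm β 1).symm) (norm_nonneg _)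
    refine ⟨s * ‖w‖ ^ 2 - β * (t * ‖u‖ ^ 2), t * ‖u‖ ^ 2, sub_nonneg.mpr hcone, by positivity,
      ?_, ?_⟩ <;> rw [hsum]
    · exact norm_ne_zero_iff.mp (sq_pos_iff.mp ((hnorm _ _).trans_gt (by positivity)))
    · calc √2 * ρ * ‖(s * ‖w‖ ^ 2) • u + (t * ‖u‖ ^ 2) • w‖
          ≤ s ^ 2 * ‖w‖ ^ 2 + t ^ 2 * ‖u‖ ^ 2 := sqrt_two_mul_norm_le_of_inner_eq_zero huw hρ.le hs
            ((mul_le_mul_of_nonneg_left hwv hρ.le).trans ht)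
        _ = _ := by ring
  · have hβ : 0 < β := pos_of_mul_pos_left ((by positivity : 0 ≤ s * ‖w‖ ^ 2).trans_lt hcone)
      (by positivity)
    exact ⟨0, 1, le_rfl, zero_le_one, by simpa using hv, by
      simpa using sqrt_two_mul_norm_le_of_ratio_le huw hu hρ.le hβ.le hs ht hcone.le⟩

theorem exists_conic_combination {u v : E} {ρ s t : ℝ} (hu : u ≠ 0) (hv : v ≠ 0)
    (hop : ¬ ∃ γ : ℝ, 0 < γ ∧ u = -(γ • v)) (hρ : 0 < ρ) (hs : ρ * ‖u‖ ≤ s) (ht : ρ * ‖v‖ ≤ t) :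
    ∃ x y : ℝ, 0 ≤ x ∧ 0 ≤ y ∧ x • u + y • v ≠ 0 ∧
      √2 * ρ * ‖x • u + y • v‖ ≤ x * s + y * (t + inner ℝ u v / inner ℝ u u * s) := by
  set β := inner ℝ u v / inner ℝ u u with hβ
  have hvw : β • u + (v - β • u) = v := add_sub_cancel _ _
  have huw : inner ℝ u (v - β • u) = 0 := by
    rw [inner_sub_right, inner_smul_right, hβ, div_mul_cancel₀ _ (inner_self_ne_zero.mpr hu),
      sub_self]
  rw [← hvw] at hv hop ht
  have h := exists_conic_combination_of_inner_eq_zero huw hu hv hop hρ hs ht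
  rwa [hvw] at h

end Geometry

/-! ## Correctness and termination of D&C -/

section DivideAndConquer

variable {I K J : Type} [Fintype J]

theorem one_add_theta_pos : 0 < 1 + theta := by norm_num [theta]

theorem one_add_theta_le_sqrt_two : 1 + theta ≤ √2 := by
  apply Real.le_sqrt_of_sq_le
  norm_num [theta]

theorem inner_projHyperplane (h h' : EuclideanSpace ℝ J) (δ : ℝ) (z : EuclideanSpace ℝ J) :
    inner ℝ h' (projHyperplane h δ z) =
      inner ℝ h' z - inner ℝ h h' / inner ℝ h h * (inner ℝ h z - δ) := by
  rw [projHyperplane, inner_sub_right, inner_smul_right, real_inner_comm h h']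
  ring

theorem exists_convex_combination {h₁ h₂ z : EuclideanSpace ℝ J} {δ₁ δ₂ ρ : ℝ} (hρ : 0 < ρ)
    (hh₁ : h₁ ≠ 0) (hh₂ : h₂ ≠ 0) (hs₁ : ρ * ‖h₁‖ ≤ inner ℝ h₁ z - δ₁)
    (hs₂ : ρ * ‖h₂‖ ≤ inner ℝ h₂ (projHyperplane h₁ δ₁ z) - δ₂)
    (hop : ¬ ∃ γ : ℝ, 0 < γ ∧ h₁ = -(γ • h₂)) :
    ∃ α : ℝ, 0 ≤ α ∧ α ≤ 1 ∧ (1 + theta) * ρ ≤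
      (inner ℝ (α • h₁ + (1 - α) • h₂) z - (α * δ₁ + (1 - α) * δ₂)) /
        ‖α • h₁ + (1 - α) • h₂‖ := by
  obtain ⟨x, y, hx, hy, hne, hle⟩ := exists_conic_combination hh₁ hh₂ hop hρ hs₁ hs₂
  have hxy : 0 < x + y := by
    refine (add_nonneg hx hy).lt_of_ne fun h => hne ?_
    rw [(add_eq_zero_iff_of_nonneg hx hy).mp h.symm |>.1,
      (add_eq_zero_iff_of_nonneg hx hy).mp h.symm |>.2, zero_smul, zero_smul, add_zero]
  have hα : 1 - x / (x + y) = y / (x + y) := by rw [one_sub_div hxy.ne', add_sub_cancel_left]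
  have hcomb : (x / (x + y)) • h₁ + (y / (x + y)) • h₂ = (x + y)⁻¹ • (x • h₁ + y • h₂) := by
    module
  refine ⟨x / (x + y), by positivity, div_le_one_of_le₀ (by linarith) hxy.le, ?_⟩
  rw [hα, hcomb, norm_smul, Real.norm_of_nonneg (by positivity), le_div_iff₀ (by positivity)]
  calc (1 + theta) * ρ * ((x + y)⁻¹ * ‖x • h₁ + y • h₂‖)
      ≤ √2 * ρ * ((x + y)⁻¹ * ‖x • h₁ + y • h₂‖) := by
        gcongr
        exact one_add_theta_le_sqrt_two
    _ = (x + y)⁻¹ * (√2 * ρ * ‖x • h₁ + y • h₂‖) := by ring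
    _ ≤ (x + y)⁻¹ * (x * (inner ℝ h₁ z - δ₁) + y * (inner ℝ h₂ z - δ₂)) := by
        gcongr
        exact hle.trans_eq (by rw [inner_projHyperplane]; ring)
    _ = _ := by
        simp only [inner_smul_left, inner_add_left, conj_trivial]
        field_simp
        ring

theorem inner_row (S : LinSys I K J) (k : K) (x : EuclideanSpace ℝ J) :
    inner ℝ (S.row k) x = (S.C *ᵥ x.ofLp) k := by
  rw [LinSys.row, EuclideanSpace.inner_eq_star_dotProduct, star_trivial, Matrix.mulVec,
    dotProduct_comm]

namespace LinSys

theorem exists_isProj (S : LinSys I K J) (hS : ∃ x, S.A *ᵥ x = S.b) (z : EuclideanSpace ℝ J) :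
    ∃ p, S.IsProj z p := by
  obtain ⟨x, hx⟩ := hS
  let f : EuclideanSpace ℝ J →ₗ[ℝ] I → ℝ :=
    S.A.mulVecLin ∘ₗ (WithLp.linearEquiv 2 ℝ (J → ℝ)).toLinearMap
  have hf (y : EuclideanSpace ℝ J) : f y = S.A *ᵥ y.ofLp := rfl
  set U := LinearMap.ker f
  set x' : EuclideanSpace ℝ J := WithLp.toLp 2 x
  set q := U.starProjection (z - x')
  have hq : f q = 0 := U.starProjection_apply_mem (z - x')
  have hp : f (x' + q) = S.b := by rw [map_add, hq, add_zero, hf, hx]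
  refine ⟨x' + q, hp, fun y hy => ?_⟩
  rw [← sub_sub]
  refine U.starProjection_inner_eq_zero (z - x') _ ?_
  rw [LinearMap.mem_ker, map_sub, hp, hf, hy, sub_self]

theorem norm_row_le [Finite K] (S : LinSys I K J) (k : K) : ‖S.row k‖ ≤ S.normCmax :=
  le_ciSup (f := fun k => ‖S.row k‖) (Set.finite_range _).bddAbove k

/-- The inequality `h x ≤ δ` is valid for `S`, has a nonzero normal, and is violated at `z` by a
distance of at least `r`. This is the guarantee on a hyperplane returned by D&C at `(z, r)`. -/
def Separates (S : LinSys I K J) (z : EuclideanSpace ℝ J) (r : ℝ) (h : EuclideanSpace ℝ J)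
    (δ : ℝ) : Prop :=
  h ≠ 0 ∧ (∀ x : EuclideanSpace ℝ J, S.Feasible x.ofLp → inner ℝ h x ≤ δ) ∧
    r * ‖h‖ ≤ inner ℝ h z - δ

theorem Separates.combine {S : LinSys I K J} {z z₁ z₂ h₁ h₂ : EuclideanSpace ℝ J}
    {r r₁ r₂ δ₁ δ₂ α : ℝ} (hr : 0 < r) (hs₁ : S.Separates z₁ r₁ h₁ δ₁)
    (hs₂ : S.Separates z₂ r₂ h₂ δ₂) (hα₀ : 0 ≤ α) (hα₁ : α ≤ 1)
    (hα : r ≤ (inner ℝ (α • h₁ + (1 - α) • h₂) z - (α * δ₁ + (1 - α) * δ₂)) /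
      ‖α • h₁ + (1 - α) • h₂‖) :
    S.Separates z r (α • h₁ + (1 - α) • h₂) (α * δ₁ + (1 - α) * δ₂) := by
  have hne : α • h₁ + (1 - α) • h₂ ≠ 0 := fun h => by
    rw [h, norm_zero, div_zero] at hα
    exact hr.not_ge hα
  refine ⟨hne, fun x hx => ?_, (le_div_iff₀ (norm_pos_iff.mpr hne)).mp hα⟩
  rw [inner_add_left, inner_smul_left, inner_smul_left, conj_trivial, conj_trivial]
  exact add_le_add (mul_le_mul_of_nonneg_left (hs₁.2.1 x hx) hα₀)
    (mul_le_mul_of_nonneg_left (hs₂.2.1 x hx) (sub_nonneg.mpr hα₁))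

theorem Separates.not_feasible_of_opposite {S : LinSys I K J} {z h₁ h₂ : EuclideanSpace ℝ J}
    {r r' δ₁ δ₂ : ℝ} (hr : 0 < r) (hs₁ : S.Separates z r' h₁ δ₁)
    (hs₂ : S.Separates (projHyperplane h₁ δ₁ z) r h₂ δ₂)
    (hop : ∃ γ : ℝ, 0 < γ ∧ h₁ = -(γ • h₂)) (x : J → ℝ) : ¬ S.Feasible x := by
  intro hx
  obtain ⟨γ, hγ, hop⟩ := hop
  have hinner (y : EuclideanSpace ℝ J) : inner ℝ h₁ y = -(γ * inner ℝ h₂ y) := by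
    rw [hop, inner_neg_left, inner_smul_left, conj_trivial]
  have hproj : inner ℝ h₁ (projHyperplane h₁ δ₁ z) = δ₁ := by
    rw [inner_projHyperplane, div_self (inner_self_ne_zero.mpr hs₁.1), one_mul, sub_sub_cancel]
  have h₁x : inner ℝ h₁ (WithLp.toLp 2 x) ≤ δ₁ := hs₁.2.1 _ hx
  have h₂x : inner ℝ h₂ (WithLp.toLp 2 x) ≤ δ₂ := hs₂.2.1 _ hx
  have hviolated : δ₂ < inner ℝ h₂ (projHyperplane h₁ δ₁ z) :=
    sub_pos.mp ((mul_pos hr (norm_pos_iff.mpr hs₂.1)).trans_le hs₂.2.2)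
  rw [hinner] at hproj h₁x
  have hle : inner ℝ h₂ (projHyperplane h₁ δ₁ z) ≤ inner ℝ h₂ (WithLp.toLp 2 x) :=
    le_of_mul_le_mul_left (neg_le_neg_iff.mp (h₁x.trans_eq hproj.symm)) hγ
  exact (hle.trans h₂x).not_gt hviolated

end LinSys

/-- The guarantee on the outcome of a call of D&C on `S` at `(z, r, ε)`: a solution satisfies the
equations exactly and the inequalities up to `ε`, a hyperplane is violated at distance `r`, and
failure certifies infeasibility. -/
def Outcome.IsSound (S : LinSys I K J) (ε : ℝ) (z : EuclideanSpace ℝ J) (r : ℝ) :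
    Outcome (EuclideanSpace ℝ J) → Prop
  | .solution x => S.A *ᵥ x.ofLp = S.b ∧ ∀ k, (S.C *ᵥ x.ofLp) k < S.d k + ε
  | .hyperplane h δ => S.Separates z r h δ
  | .failure => ∀ x, ¬ S.Feasible x

theorem EP.isSound [Finite K] {S : LinSys I K J} (hrow : ∀ k, S.row k ≠ 0) {ε r : ℝ}
    {z : EuclideanSpace ℝ J} {o} (hr : 0 < r) (hrε : r ≤ ε / (2 * S.normCmax))
    (ho : EP S z r o) : o.IsSound S ε z r := by
  cases ho with
  | solution p hp hdist hviol =>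
    refine ⟨hp.1, fun k => ?_⟩
    have hk : 0 < ‖S.row k‖ := norm_pos_iff.mpr (hrow k)
    have hz : (S.C *ᵥ z.ofLp) k - S.d k < r * ‖S.row k‖ := (div_lt_iff₀ hk).mp (hviol k)
    have hpz : (S.C *ᵥ p.ofLp) k - (S.C *ᵥ z.ofLp) k ≤ ‖S.row k‖ * r := by
      rw [← inner_row, ← inner_row, ← inner_sub_right]
      exact (real_inner_le_norm _ _).trans (by gcongr)
    have hrow_le : r * ‖S.row k‖ ≤ r * S.normCmax := by
      gcongr
      exact S.norm_row_le k
    have hε : r * (2 * S.normCmax) ≤ ε :=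
      (le_div_iff₀ (by linarith [S.norm_row_le k])).mp hrε
    linarith
  | affine p hp hdist =>
    rw [norm_sub_rev] at hdist
    refine ⟨norm_pos_iff.mp (hr.trans_le hdist), fun x hx => ?_, ?_⟩
    · rw [← sub_nonpos, ← inner_sub_right, hp.2 x hx.1]
    · rw [← inner_sub_right, real_inner_self_eq_norm_sq, sq]
      gcongr
  | violated p hp hdist k hk =>
    refine ⟨hrow k, fun x hx => ?_, ?_⟩
    · rw [inner_row]
      exact hx.2 k
    · rw [inner_row]
      exact (le_div_iff₀ (norm_pos_iff.mpr (hrow k))).mp hk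

theorem EP.exists {S : LinSys I K J} (hS : ∃ x, S.A *ᵥ x = S.b) (z : EuclideanSpace ℝ J) (r : ℝ) :
    ∃ o, EP S z r o := by
  obtain ⟨p, hp⟩ := S.exists_isProj hS z
  rcases le_or_gt r ‖p - z‖ with hdist | hdist
  · exact ⟨_, .affine p hp hdist⟩
  by_cases hviol : ∃ k, r ≤ ((S.C *ᵥ z.ofLp) k - S.d k) / ‖S.row k‖
  · obtain ⟨k, hk⟩ := hviol
    exact ⟨_, .violated p hp hdist k hk⟩
  · push Not at hviol
    exact ⟨_, .solution p hp hdist hviol⟩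

/-- The stack of pending calls of a run of D&C started at `(z₀, r₀)` is consistent with the
parameters `z`, `r` of the call being executed. -/
def StackSound (S : LinSys I K J) (z₀ : EuclideanSpace ℝ J) (r₀ : ℝ) :
    List (Frame (EuclideanSpace ℝ J)) → EuclideanSpace ℝ J → ℝ → Prop
  | [], z, r => z = z₀ ∧ r = r₀
  | .first z' r' :: L, z, r => z = z' ∧ r = r' / (1 + theta) ∧ StackSound S z₀ r₀ L z' r'
  | .second z' r' h δ :: L, z, r => z = projHyperplane h δ z' ∧ r = r' / (1 + theta) ∧
      S.Separates z' r h δ ∧ StackSound S z₀ r₀ L z' r'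

theorem StackSound.tail {S : LinSys I K J} {z₀ : EuclideanSpace ℝ J} {r₀ : ℝ} {F L z r}
    (hr : 0 < r) (h : StackSound S z₀ r₀ (F :: L) z r) :
    ∃ z' r', 0 < r' ∧ StackSound S z₀ r₀ L z' r' := by
  cases F with
  | first z' r' =>
    obtain ⟨-, rfl, hL⟩ := h
    exact ⟨z', r', (div_pos_iff_of_pos_right one_add_theta_pos).mp hr, hL⟩
  | second z' r' h₁ δ₁ =>
    obtain ⟨-, rfl, -, hL⟩ := h
    exact ⟨z', r', (div_pos_iff_of_pos_right one_add_theta_pos).mp hr, hL⟩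

/-- The invariant of a run of D&C started at `(z₀, r₀)`: the stack is consistent, and an outcome
about to be returned is sound for the call that produced it. -/
def DCState.IsSound (S : LinSys I K J) (ε : ℝ) (z₀ : EuclideanSpace ℝ J) (r₀ : ℝ) :
    DCState (EuclideanSpace ℝ J) → Prop
  | .call z r L => 0 < r ∧ StackSound S z₀ r₀ L z r
  | .ret o L => ∃ z r, 0 < r ∧ StackSound S z₀ r₀ L z r ∧ o.IsSound S ε z r

theorem DCState.IsSound.step [Finite K] {S : LinSys I K J} (hrow : ∀ k, S.row k ≠ 0) {ε : ℝ}
    {z₀ : EuclideanSpace ℝ J} {r₀ : ℝ} {s s'} (hs : s.IsSound S ε z₀ r₀) (h : DCStep S ε s s') :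
    s'.IsSound S ε z₀ r₀ := by
  cases h with
  | base z r L o hr ho => exact ⟨z, r, hs.1, hs.2, ho.isSound hrow hs.1 hr⟩
  | recurse z r L hr => exact ⟨div_pos hs.1 one_add_theta_pos, rfl, rfl, hs.2⟩
  | found x F L =>
    obtain ⟨z, r, hr, hL, ho⟩ := hs
    obtain ⟨z', r', hr', hL'⟩ := hL.tail hr
    exact ⟨z', r', hr', hL', ho⟩
  | failed F L =>
    obtain ⟨z, r, hr, hL, ho⟩ := hs
    obtain ⟨z', r', hr', hL'⟩ := hL.tail hr
    exact ⟨z', r', hr', hL', ho⟩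
  | project z' r' h₁ δ₁ L =>
    obtain ⟨z, r, hr, ⟨rfl, rfl, hL⟩, ho⟩ := hs
    exact ⟨hr, rfl, rfl, ho, hL⟩
  | opposite z' r' h₁ δ₁ h₂ δ₂ L hop =>
    obtain ⟨z, r, hr, hL, hsep₂⟩ := hs
    obtain ⟨z'', r'', hr'', hL''⟩ := hL.tail hr
    obtain ⟨rfl, -, hsep₁, -⟩ := hL
    exact ⟨z'', r'', hr'', hL'', hsep₁.not_feasible_of_opposite hr hsep₂ hop⟩
  | combine z' r' h₁ δ₁ h₂ δ₂ L α hop hα₀ hα₁ hα =>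
    obtain ⟨z, r, hr, ⟨-, rfl, hsep₁, hL⟩, hsep₂⟩ := hs
    have hr' : 0 < r' := (div_pos_iff_of_pos_right one_add_theta_pos).mp hr
    exact ⟨z', r', hr', hL, hsep₁.combine hr' hsep₂ hα₀ hα₁ hα⟩

theorem DCState.IsSound.progress {S : LinSys I K J} (hS : ∃ x, S.A *ᵥ x = S.b) {ε : ℝ}
    {z₀ : EuclideanSpace ℝ J} {r₀ : ℝ} {s : DCState (EuclideanSpace ℝ J)}
    (hs : s.IsSound S ε z₀ r₀) : (∃ s', DCStep S ε s s') ∨ ∃ o, s = .ret o [] := by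
  match s, hs with
  | .call z r L, _ =>
    left
    by_cases hr : r ≤ ε / (2 * S.normCmax)
    · obtain ⟨o, ho⟩ := EP.exists hS z r
      exact ⟨_, .base z r L o hr ho⟩
    · exact ⟨_, .recurse z r L hr⟩
  | .ret o [], _ => exact .inr ⟨o, rfl⟩
  | .ret (.solution x) (F :: L), _ => exact .inl ⟨_, .found x F L⟩
  | .ret .failure (F :: L), _ => exact .inl ⟨_, .failed F L⟩
  | .ret (.hyperplane h δ) (.first z r :: L), _ => exact .inl ⟨_, .project z r h δ L⟩
  | .ret (.hyperplane h₂ δ₂) (.second z' r' h₁ δ₁ :: L), hs =>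
    left
    by_cases hop : ∃ γ : ℝ, 0 < γ ∧ h₁ = -(γ • h₂)
    · exact ⟨_, .opposite z' r' h₁ δ₁ h₂ δ₂ L hop⟩
    obtain ⟨z, r, hr, ⟨rfl, rfl, hsep₁, -⟩, hsep₂⟩ := hs
    obtain ⟨α, hα₀, hα₁, hα⟩ :=
      exists_convex_combination hr hsep₁.1 hsep₂.1 hsep₁.2.2 hsep₂.2.2 hop
    rw [mul_div_cancel₀ _ one_add_theta_pos.ne'] at hα
    exact ⟨_, .combine z' r' h₁ δ₁ h₂ δ₂ L α hop hα₀ hα₁ hα⟩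

/-- The recursion depth of D&C at radius `r` when the base case is `r ≤ c`. -/
noncomputable def recursionDepth (c r : ℝ) : ℕ := ⌈Real.logb (1 + theta) (r / c)⌉₊

theorem recursionDepth_div_lt {c r : ℝ} (hc : 0 < c) (hr : c < r) :
    recursionDepth c (r / (1 + theta)) < recursionDepth c r := by
  have hθ : 1 < 1 + theta := by norm_num [theta]
  have hpos : 0 < Real.logb (1 + theta) (r / c) := Real.logb_pos hθ ((one_lt_div hc).mpr hr)
  rw [recursionDepth, recursionDepth, div_right_comm,
    Real.logb_div (div_pos (hc.trans hr) hc).ne' one_add_theta_pos.ne',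
    Real.logb_self_eq_one hθ, Nat.ceil_sub_one]
  exact Nat.sub_one_lt (Nat.ceil_pos.mpr hpos).ne'

/-- A bound for the number of steps of a call of D&C with the given recursion depth: two recursive
calls, one step to start each of them, and one to return. -/
def callSteps : ℕ → ℕ
  | 0 => 1
  | d + 1 => 2 * callSteps d + 3

theorem callSteps_mono : Monotone callSteps :=
  monotone_nat_of_le_succ fun d => by
    rw [callSteps]
    omega

theorem callSteps_pos (d : ℕ) : 0 < callSteps d := by cases d <;> simp [callSteps]

/-- A bound for the number of steps still to be executed by the pending calls. -/
noncomputable def pendingSteps {E : Type} (c : ℝ) : List (Frame E) → ℕ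
  | [] => 0
  | .first _ r :: L => 2 + callSteps (recursionDepth c (r / (1 + theta))) + pendingSteps c L
  | .second _ _ _ _ :: L => 1 + pendingSteps c L

theorem pendingSteps_lt_cons {E : Type} (c : ℝ) (F : Frame E) (L : List (Frame E)) :
    pendingSteps c L < pendingSteps c (F :: L) := by
  cases F <;> rw [pendingSteps] <;> omega

/-- A bound for the number of steps of D&C from a given configuration. -/
noncomputable def DCState.stepBound {E : Type} (c : ℝ) : DCState E → ℕ
  | .call _ r L => callSteps (recursionDepth c r) + pendingSteps c L
  | .ret _ L => pendingSteps c L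

theorem DCStep.stepBound_lt {S : LinSys I K J} {ε : ℝ} (hc : 0 < ε / (2 * S.normCmax)) {s s'}
    (h : DCStep S ε s s') :
    s'.stepBound (ε / (2 * S.normCmax)) < s.stepBound (ε / (2 * S.normCmax)) := by
  cases h with
  | base z r L o hr ho => exact Nat.lt_add_of_pos_left (callSteps_pos _)
  | recurse z r L hr =>
    have hdepth := callSteps_mono (Nat.succ_le_of_lt (recursionDepth_div_lt hc (not_le.mp hr)))
    simp only [callSteps] at hdepth
    simp only [DCState.stepBound, pendingSteps]
    omega
  | project z r h₁ δ₁ L =>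
    simp only [DCState.stepBound, pendingSteps]
    omega
  | found | failed | opposite | combine => exact pendingSteps_lt_cons _ _ _

end DivideAndConquer

/-! ## Small points of rational polyhedra -/

section RationalPolyhedra

theorem one_add_sum_le_prod_one_add {ι R : Type*} [CommSemiring R] [PartialOrder R]
    [IsOrderedRing R] (s : Finset ι) {f : ι → R} (hf : ∀ i ∈ s, 0 ≤ f i) :
    1 + ∑ i ∈ s, f i ≤ ∏ i ∈ s, (1 + f i) := by
  classical
  induction s using Finset.induction_on with
  | empty => simp
  | insert a s ha ih =>
    have hs : ∀ i ∈ s, 0 ≤ f i := fun i hi => hf i (Finset.mem_insert_of_mem hi)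
    have hfa : 0 ≤ f a := hf a (Finset.mem_insert_self a s)
    rw [Finset.sum_insert ha, Finset.prod_insert ha]
    calc 1 + (f a + ∑ i ∈ s, f i) ≤ 1 + (f a + ∑ i ∈ s, f i) + f a * ∑ i ∈ s, f i :=
          le_add_of_nonneg_right (mul_nonneg hfa (Finset.sum_nonneg hs))
      _ = (1 + f a) * (1 + ∑ i ∈ s, f i) := by ring
      _ ≤ (1 + f a) * ∏ i ∈ s, (1 + f i) :=
          mul_le_mul_of_nonneg_left (ih hs) (add_nonneg zero_le_one hfa)

theorem one_add_natAbs_num_mul_one_add_den_le (q : ℚ) :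
    (1 + q.num.natAbs) * (1 + q.den) ≤ 2 ^ ratSize q :=
  calc (1 + q.num.natAbs) * (1 + q.den)
      ≤ 2 ^ Nat.clog 2 (q.num.natAbs + 1) * 2 ^ Nat.clog 2 (q.den + 1) := by
        rw [add_comm 1, add_comm 1]
        exact Nat.mul_le_mul (Nat.le_pow_clog one_lt_two _) (Nat.le_pow_clog one_lt_two _)
    _ ≤ 2 ^ ratSize q := by
        rw [← pow_add, ratSize]
        exact Nat.pow_le_pow_right two_pos (by omega)

theorem sum_natAbs_num_mul_prod_den_le {α : Type*} [Fintype α] (q : α → ℚ) :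
    (∑ i, (q i).num.natAbs) * ∏ i, (q i).den ≤ 2 ^ ∑ i, ratSize (q i) :=
  calc (∑ i, (q i).num.natAbs) * ∏ i, (q i).den
      ≤ (∏ i, (1 + (q i).num.natAbs)) * ∏ i, (1 + (q i).den) := by
        refine Nat.mul_le_mul ?_ (Finset.prod_le_prod' fun i _ => Nat.le_add_left _ _)
        exact (Nat.le_add_left _ _).trans
          (one_add_sum_le_prod_one_add _ fun i _ => Nat.zero_le _)
    _ ≤ ∏ i, 2 ^ ratSize (q i) := by
        rw [← Finset.prod_mul_distrib]
        exact Finset.prod_le_prod' fun i _ => one_add_natAbs_num_mul_one_add_den_le _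
    _ = 2 ^ ∑ i, ratSize (q i) := Finset.prod_pow_eq_pow_sum _ _ _

theorem exists_int_scaling {α : Type*} [Fintype α] (q : α → ℚ) :
    ∃ (Q : ℕ) (a : α → ℤ), 0 < Q ∧ (∀ i, (a i : ℚ) = Q * q i) ∧
      ∑ i, |a i| ≤ 2 ^ ∑ i, ratSize (q i) := by
  have hdvd (i : α) : (q i).den ∣ ∏ j, (q j).den := Finset.dvd_prod_of_mem _ (Finset.mem_univ i)
  choose c hc using hdvd
  have hden : 0 < ∏ i, (q i).den := Finset.prod_pos fun i _ => (q i).den_pos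
  refine ⟨∏ i, (q i).den, fun i => (q i).num * c i, hden, fun i => ?_, ?_⟩
  · rw [hc i]
    push_cast
    rw [← (q i).mul_den_eq_num]
    ring
  · have hsum : ∑ i, (q i).num.natAbs * c i ≤ (∑ i, (q i).num.natAbs) * ∏ i, (q i).den := by
      rw [Finset.sum_mul]
      refine Finset.sum_le_sum fun i _ => Nat.mul_le_mul_left _ ?_
      rw [hc i]
      exact Nat.le_mul_of_pos_left _ (q i).den_pos
    have hnat := hsum.trans (sum_natAbs_num_mul_prod_den_le q)
    zify at hnat
    simpa only [abs_mul, Nat.abs_cast] using hnat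

theorem exists_abs_le_pow_of_int {ι J 𝕜 : Type*} [Field 𝕜] [LinearOrder 𝕜]
    [IsStrictOrderedRing 𝕜] [Finite ι] [Fintype J] {v : ι → J → ℤ} {β : ι → ℤ} {B : ℤ}
    (hB : 1 ≤ B) (hvB : ∀ i, ∑ j, |v i j| + |β i| ≤ B)
    (hP : ∃ x : J → 𝕜, ∀ i, ∑ j, (v i j : 𝕜) * x j ≤ β i) :
    ∃ y : J → 𝕜, (∀ i, ∑ j, (v i j : 𝕜) * y j ≤ β i) ∧ ∀ j, |y j| ≤ (B : 𝕜) ^ Fintype.card J := by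
  classical
  have := Fintype.ofFinite ι
  set M : ι → J → 𝕜 := fun i j => (v i j : 𝕜)
  obtain ⟨x, hx, hspan⟩ := exists_tight_span (M := M) hP
  obtain ⟨b, hb, -, hsp, hli⟩ := exists_linearIndepOn_extension (v := M)
    (linearIndepOn_empty 𝕜 M) (Set.empty_subset {i | M i ⬝ᵥ x = β i})
  obtain ⟨y, hy, hyB⟩ := exists_solution_abs_le 𝕜 (v := fun i : b => v i) hli fun i => β i
  refine ⟨y, fun k => ?_, fun j => (hyB j).trans ?_⟩
  · have hk : M k ∈ Submodule.span 𝕜 (M '' b) := Submodule.span_le.mpr hsp (hspan k)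
    have heq : M k ⬝ᵥ y = M k ⬝ᵥ x := by
      refine dotProduct_eq_of_mem_span ?_ hk
      rintro _ ⟨i, hi, rfl⟩
      exact (hy ⟨i, hi⟩).trans (hb hi).symm
    exact heq.le.trans (hx k)
  · have hcard : Fintype.card b ≤ Fintype.card J := by
      simpa using LinearIndependent.fintype_card_le_finrank hli
    have hprod : ∏ i : b, (∑ j, |v i j| + |β i|) ≤ B ^ Fintype.card J :=
      calc ∏ i : b, (∑ j, |v i j| + |β i|) ≤ ∏ _i : b, B :=
            Finset.prod_le_prod (fun i _ => by positivity) fun i _ => hvB i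
        _ = B ^ Fintype.card b := by rw [Finset.prod_const, Finset.card_univ]
        _ ≤ B ^ Fintype.card J := pow_le_pow_right₀ hB hcard
    exact_mod_cast hprod

theorem exists_abs_le_two_pow_of_ineqSize_le {J : Type} [Fintype J] {N φ : ℕ}
    {M : Matrix (Fin N) J ℚ} {β : Fin N → ℚ} (hφ : ∀ i, ineqSize (M i) (β i) ≤ φ)
    (hP : ∃ x : J → ℝ, ∀ i, ∑ j, (M i j : ℝ) * x j ≤ β i) :
    ∃ y : J → ℝ, (∀ i, ∑ j, (M i j : ℝ) * y j ≤ β i) ∧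
      ∀ j, |y j| ≤ 2 ^ (φ * Fintype.card J) := by
  choose Q a hQ ha hle using fun i => exists_int_scaling fun o : Option J => o.elim (β i) (M i)
  have hscaled (x : J → ℝ) (i : Fin N) :
      ∑ j, (a i (some j) : ℝ) * x j ≤ a i none ↔ ∑ j, (M i j : ℝ) * x j ≤ β i := by
    have hQi : (0 : ℝ) < Q i := Nat.cast_pos.mpr (hQ i)
    have hcast (o : Option J) : (a i o : ℝ) = Q i * (o.elim (β i) (M i) : ℚ) := by
      exact_mod_cast congrArg (Rat.cast : ℚ → ℝ) (ha i o)
    simp only [hcast, Option.elim, mul_assoc]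
    rw [← Finset.mul_sum, mul_le_mul_iff_right₀ hQi]
  have hsize (i : Fin N) : ∑ j, |a i (some j)| + |a i none| ≤ 2 ^ φ := by
    have hi := hle i
    rw [Fintype.sum_option, Fintype.sum_option, add_comm |a i none|] at hi
    refine hi.trans (pow_le_pow_right₀ one_le_two ?_)
    have hφi := hφ i
    simp only [ineqSize] at hφi
    simp only [Option.elim]
    omega
  simp only [← hscaled] at hP ⊢
  obtain ⟨y, hy, hyB⟩ := exists_abs_le_pow_of_int (one_le_pow₀ one_le_two) hsize hP
  exact ⟨y, hy, by simpa [pow_mul] using hyB⟩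

/-- `P` is the solution set of a finite system of linear inequalities with rational coefficients:
the sets for which `facetComplexity` is not the junk value `sInf ∅`. -/
def IsRationalPolyhedron {J : Type} [Fintype J] (P : Set (J → ℝ)) : Prop :=
  ∃ (N : ℕ) (M : Matrix (Fin N) J ℚ) (β : Fin N → ℚ),
    P = {x | ∀ i, ∑ j, (M i j : ℝ) * x j ≤ (β i : ℝ)}

variable {J : Type} [Fintype J]

theorem IsRationalPolyhedron.facetComplexity_mem {P : Set (J → ℝ)}
    (hP : IsRationalPolyhedron P) : Fintype.card J ≤ facetComplexity P ∧
      ∃ (N : ℕ) (M : Matrix (Fin N) J ℚ) (β : Fin N → ℚ),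
        P = {x | ∀ i, ∑ j, (M i j : ℝ) * x j ≤ (β i : ℝ)} ∧
        ∀ i, ineqSize (M i) (β i) ≤ facetComplexity P := by
  obtain ⟨N, M, β, h⟩ := hP
  refine Nat.sInf_mem (s := {φ : ℕ | Fintype.card J ≤ φ ∧ ∃ (N : ℕ) (M : Matrix (Fin N) J ℚ)
    (β : Fin N → ℚ), P = {x | ∀ i, ∑ j, (M i j : ℝ) * x j ≤ (β i : ℝ)} ∧
      ∀ i, ineqSize (M i) (β i) ≤ φ}) ⟨Fintype.card J + ∑ i, ineqSize (M i) (β i),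
    Nat.le_add_right _ _, N, M, β, h, fun i => ?_⟩
  exact (Finset.single_le_sum (f := fun i => ineqSize (M i) (β i))
    (fun _ _ => Nat.zero_le _) (Finset.mem_univ i)).trans (Nat.le_add_left _ _)

theorem norm_toLp_le_mul_sqrt_card {y : J → ℝ} {B : ℝ} (hB : 0 ≤ B) (hy : ∀ j, |y j| ≤ B) :
    ‖WithLp.toLp 2 y‖ ≤ B * √(Fintype.card J) := by
  have hsum : ∑ j, ‖y j‖ ^ 2 ≤ B ^ 2 * Fintype.card J :=
    calc ∑ j, ‖y j‖ ^ 2 ≤ Finset.card Finset.univ • B ^ 2 :=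
          Finset.sum_le_card_nsmul _ _ _ fun j _ => pow_le_pow_left₀ (norm_nonneg _) (hy j) 2
      _ = B ^ 2 * Fintype.card J := by rw [Finset.card_univ, nsmul_eq_mul, mul_comm]
  rw [EuclideanSpace.norm_eq]
  refine (Real.sqrt_le_sqrt hsum).trans_eq ?_
  rw [Real.sqrt_mul (sq_nonneg B), Real.sqrt_sq hB]

variable [Nonempty J]

theorem IsRationalPolyhedron.exists_norm_lt_schrijverRadius {P : Set (J → ℝ)}
    (hP : IsRationalPolyhedron P) (hne : P.Nonempty) :
    ∃ y : EuclideanSpace ℝ J, y.ofLp ∈ P ∧ ‖y‖ < schrijverRadius P := by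
  obtain ⟨hcard, N, M, β, hPeq, hφ⟩ := hP.facetComplexity_mem
  have hne' : {x : J → ℝ | ∀ i, ∑ j, (M i j : ℝ) * x j ≤ β i}.Nonempty := hPeq ▸ hne
  obtain ⟨y, hy, hyB⟩ := exists_abs_le_two_pow_of_ineqSize_le hφ hne'
  refine ⟨WithLp.toLp 2 y, hPeq.symm.subset hy, ?_⟩
  have hJ : 0 < Fintype.card J := Fintype.card_pos
  have hexp : facetComplexity P * Fintype.card J < 5 * Fintype.card J ^ 2 * facetComplexity P := by
    have : 0 < facetComplexity P * Fintype.card J := Nat.mul_pos (hJ.trans_le hcard) hJ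
    nlinarith
  refine (norm_toLp_le_mul_sqrt_card (by positivity) hyB).trans_lt ?_
  rw [schrijverRadius]
  gcongr
  exact one_lt_two

theorem schrijverRadius_pos (P : Set (J → ℝ)) : 0 < schrijverRadius P :=
  mul_pos (by positivity) (Real.sqrt_pos.mpr (Nat.cast_pos.mpr Fintype.card_pos))

end RationalPolyhedra

theorem LinSys.isRationalPolyhedron {I K J : Type} [Finite I] [Finite K] [Fintype J]
    {S : LinSys I K J} (hA : ∀ i j, ∃ q : ℚ, (q : ℝ) = S.A i j) (hb : ∀ i, ∃ q : ℚ, (q : ℝ) = S.b i)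
    (hC : ∀ k j, ∃ q : ℚ, (q : ℝ) = S.C k j) (hd : ∀ k, ∃ q : ℚ, (q : ℝ) = S.d k) :
    IsRationalPolyhedron {y | S.Feasible y} := by
  choose A hA using hA
  choose b hb using hb
  choose C hC using hC
  choose d hd using hd
  let e := Finite.equivFin (I ⊕ I ⊕ K)
  refine ⟨_, Matrix.of fun i => Sum.elim A (Sum.elim (-A) C) (e.symm i),
    fun i => Sum.elim b (Sum.elim (-b) d) (e.symm i), ?_⟩
  ext y
  simp only [Set.mem_ofPred_eq, Matrix.of_apply, LinSys.Feasible]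
  rw [e.symm.forall_congr_left]
  simp only [Equiv.symm_symm, Equiv.symm_apply_apply, Sum.forall, Sum.elim_inl, Sum.elim_inr,
    Pi.neg_apply, Rat.cast_neg, hA, hb, hC, hd, neg_mul, Finset.sum_neg_distrib, neg_le_neg_iff]
  rw [← and_assoc, ← forall_and, funext_iff]
  simp only [← le_antisymm_iff]
  rfl

/-! ## Rounding -/

section IntegerRelations

variable {ι J : Type*} [Fintype ι]

theorem sum_mul_eq_of_int_relation {R : Type*} [CommRing R] [Fintype J] {v : ι → J → ℤ}
    {u : J → ℤ} {Δ : ℤ} {μ : ι → ℤ} (hrel : Δ • u = ∑ i, μ i • v i) (z : J → R) :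
    Δ * ∑ j, (u j : R) * z j = ∑ i, μ i * ∑ j, (v i j : R) * z j := by
  have hcoord (j : J) : (Δ : R) * u j = ∑ i, (μ i : R) * v i j := by
    have hj := congrFun hrel j
    simp only [Pi.smul_apply, Finset.sum_apply, smul_eq_mul] at hj
    exact_mod_cast congrArg (Int.cast : ℤ → R) hj
  simp only [Finset.mul_sum, ← mul_assoc, hcoord, Finset.sum_mul]
  exact Finset.sum_comm

-- `Δ (u y - γ)` is an integer, and by the hypotheses on `x` it is less than `1`.
theorem sum_mul_le_of_int_relation {𝕜 : Type*} [CommRing 𝕜] [LinearOrder 𝕜]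
    [IsStrictOrderedRing 𝕜] [Fintype J] {v : ι → J → ℤ} {β : ι → ℤ} {u : J → ℤ} {γ Δ : ℤ}
    {μ : ι → ℤ} {x y : J → 𝕜} {ν : 𝕜} (hΔ : 0 < Δ) (hrel : Δ • u = ∑ i, μ i • v i)
    (hy : ∀ i, ∑ j, (v i j : 𝕜) * y j = β i) (hx : ∀ i, |∑ j, (v i j : 𝕜) * x j - β i| ≤ ν)
    (hux : ∑ j, (u j : 𝕜) * x j < γ + ν) (hν : ν * ((Δ + ∑ i, |μ i| : ℤ) : 𝕜) ≤ 1) :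
    ∑ j, (u j : 𝕜) * y j ≤ γ := by
  have hΔ' : (0 : 𝕜) < Δ := Int.cast_pos.mpr hΔ
  have hint : Δ * (∑ j, (u j : 𝕜) * y j - γ) = ((∑ i, μ i * β i - Δ * γ : ℤ) : 𝕜) := by
    rw [mul_sub, sum_mul_eq_of_int_relation hrel]
    simp only [hy]
    push_cast
    rfl
  have hdiff : Δ * (∑ j, (u j : 𝕜) * y j - γ) = Δ * (∑ j, (u j : 𝕜) * x j - γ) -
      ∑ i, μ i * (∑ j, (v i j : 𝕜) * x j - β i) := by
    simp only [mul_sub, Finset.sum_sub_distrib, sum_mul_eq_of_int_relation hrel, hy]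
    ring
  have herror : -∑ i, μ i * (∑ j, (v i j : 𝕜) * x j - β i) ≤ ∑ i, |(μ i : 𝕜)| * ν :=
    calc -∑ i, μ i * (∑ j, (v i j : 𝕜) * x j - β i)
        ≤ ∑ i, |μ i * (∑ j, (v i j : 𝕜) * x j - β i)| :=
          (neg_le_abs _).trans (Finset.abs_sum_le_sum_abs _ _)
      _ ≤ ∑ i, |(μ i : 𝕜)| * ν := by
          gcongr with i
          rw [abs_mul]
          gcongr
          exact hx i
  have hlt : Δ * (∑ j, (u j : 𝕜) * y j - γ) < 1 :=
    calc Δ * (∑ j, (u j : 𝕜) * y j - γ)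
        < Δ * ν + ∑ i, |(μ i : 𝕜)| * ν := by
          rw [hdiff, sub_eq_add_neg]
          refine add_lt_add_of_lt_of_le ?_ herror
          gcongr
          exact sub_left_lt_of_lt_add hux
      _ = ν * ((Δ + ∑ i, |μ i| : ℤ) : 𝕜) := by
          push_cast
          rw [← Finset.sum_mul]
          ring
      _ ≤ 1 := hν
  rw [hint] at hlt
  have hnonpos : Δ * (∑ j, (u j : 𝕜) * y j - γ) ≤ 0 := by
    rw [hint]
    exact_mod_cast Int.lt_add_one_iff.mp (by exact_mod_cast hlt)
  exact sub_nonpos.mp (nonpos_of_mul_nonpos_right hnonpos hΔ')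

theorem exists_pos_int_relation_add_sum_abs_le (𝕜 : Type*) [Field 𝕜] [CharZero 𝕜] [Fintype J]
    {v : ι → J → ℤ} (hv : LinearIndependent 𝕜 fun i j => (v i j : 𝕜)) {u : J → ℤ}
    (hu : (fun j => (u j : 𝕜)) ∈ Submodule.span 𝕜 (Set.range fun i j => (v i j : 𝕜))) :
    ∃ (Δ : ℤ) (μ : ι → ℤ), 0 < Δ ∧ Δ • u = ∑ i, μ i • v i ∧
      Δ + ∑ i, |μ i| ≤ (1 + ∑ j, |u j|) * ∏ i, 2 * (1 + ∑ j, |v i j|) := by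
  obtain ⟨Δ, μ, hΔ, hrel, hΔle, hμ⟩ := exists_pos_int_relation 𝕜 hv hu
  refine ⟨Δ, μ, hΔ, hrel, ?_⟩
  set R : ℤ := 1 + ∑ j, |u j|
  set W : ℤ := ∏ i, (1 + ∑ j, |v i j|)
  have hR : 1 ≤ R := le_add_of_nonneg_right (by positivity)
  have hW : 0 ≤ W := by positivity
  have hsum : ∑ i, |μ i| ≤ Fintype.card ι * (R * W) := by
    rw [← nsmul_eq_mul, ← Finset.card_univ]
    exact Finset.sum_le_card_nsmul _ _ _ fun i _ => hμ i
  have hcard : (Fintype.card ι : ℤ) + 1 ≤ 2 ^ Fintype.card ι := by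
    exact_mod_cast Nat.lt_two_pow_self (n := Fintype.card ι)
  calc Δ + ∑ i, |μ i| ≤ R * W + Fintype.card ι * (R * W) :=
        add_le_add (hΔle.trans (le_mul_of_one_le_left hW hR)) hsum
    _ = (Fintype.card ι + 1) * (R * W) := by ring
    _ ≤ 2 ^ Fintype.card ι * (R * W) := by gcongr
    _ = R * ∏ i, 2 * (1 + ∑ j, |v i j|) := by
        rw [Finset.prod_mul_distrib, Finset.prod_const, Finset.card_univ]
        ring

end IntegerRelations

theorem exists_linearIndependent_sumElim_span_eq {ι κ K V : Type*} [DivisionRing K]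
    [AddCommGroup V] [Module K V] (a : ι → V) (c : κ → V) (I : Set ι) (L : Set κ) :
    ∃ I' ⊆ I, ∃ L' ⊆ L,
      LinearIndependent K (Sum.elim (fun i : I' => a i) (fun k : L' => c k)) ∧
      Submodule.span K (a '' I') = Submodule.span K (a '' I) ∧
      Submodule.span K (a '' I' ∪ c '' L') = Submodule.span K (a '' I ∪ c '' L) := by
  obtain ⟨I', hI, -, hspanI, hI'⟩ := exists_linearIndepOn_extension
    (linearIndepOn_empty K a) (Set.empty_subset I)
  set v := Sum.elim a c
  obtain ⟨s, hs, hIs, hspan, hindep⟩ := exists_linearIndepOn_extension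
    (LinearIndepOn.image_of_comp Sum.inl v hI')
    (Set.subset_union_left (t := Sum.inr '' L))
  set L' : Set κ := Sum.inr ⁻¹' s
  have hs_eq : s = Sum.inl '' I' ∪ Sum.inr '' L' := by
    ext (i | k)
    · simpa using ⟨fun h => by simpa using hs h, fun h => hIs ⟨i, h, rfl⟩⟩
    · simp [L']
  have himage (t : Set κ) : v '' (Sum.inl '' I' ∪ Sum.inr '' t) = a '' I' ∪ c '' t := by
    simp only [Set.image_union, Set.image_image, v, Sum.elim_inl, Sum.elim_inr]
  have hL : L' ⊆ L := fun k hk => by simpa using hs hk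
  have hspan_eq : Submodule.span K (a '' I') = Submodule.span K (a '' I) :=
    le_antisymm (Submodule.span_mono (Set.image_mono hI)) (Submodule.span_le.mpr hspanI)
  refine ⟨I', hI, L', hL, ?_, hspan_eq, ?_⟩
  · let e : I' ⊕ L' → s := Sum.elim (fun i => ⟨.inl i, hIs ⟨i, i.2, rfl⟩⟩) fun k => ⟨.inr k, k.2⟩
    have he : Function.Injective e := by
      rintro (i | i) (j | j) h <;> simp_all [e, Subtype.ext_iff]
    convert hindep.comp e he using 1
    ext (i | k) <;> rfl
  · rw [himage, hs_eq, himage] at hspan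
    rw [Submodule.span_union _ (c '' L), ← hspan_eq, ← Submodule.span_union]
    exact le_antisymm (Submodule.span_mono (Set.union_subset_union_right _ (Set.image_mono hL)))
      (Submodule.span_le.mpr hspan)

theorem one_add_natAbs_le_two_pow_intBits (a : ℤ) : 1 + a.natAbs ≤ 2 ^ intBits a := by
  rw [add_comm]
  exact (Nat.le_pow_clog one_lt_two _).trans
    (Nat.pow_le_pow_right two_pos (by rw [intBits]; omega))

namespace Input

variable {m l n : ℕ}

/-- The rows of `A` and `C` as one family. -/
def rows (D : Input m l n) : Fin m ⊕ Fin l → Fin n → ℤ := Sum.elim D.A D.C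

/-- The right-hand sides `b` and `d` as one family. -/
def rhs (D : Input m l n) : Fin m ⊕ Fin l → ℤ := Sum.elim D.b D.d

/-- The bit length of a row together with its right-hand side. -/
def rowBits (D : Input m l n) (s : Fin m ⊕ Fin l) : ℕ :=
  ∑ j, intBits (D.rows s j) + intBits (D.rhs s)

theorem sum_rowBits (D : Input m l n) : ∑ s, D.rowBits s = D.bitLength := by
  simp only [rowBits, bitLength, Finset.sum_add_distrib, Fintype.sum_sum_type]
  change ((∑ i, ∑ j, intBits (D.A i j)) + ∑ k, ∑ j, intBits (D.C k j)) +
    ((∑ i, intBits (D.b i)) + ∑ k, intBits (D.d k)) = _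
  ring

theorem sum_rowBits_comp_le {ι : Type*} [Fintype ι] (D : Input m l n) {σ : ι → Fin m ⊕ Fin l}
    (hσ : Function.Injective σ) : ∑ i, D.rowBits (σ i) ≤ D.bitLength :=
  (sum_comp_le_sum_of_injective hσ fun _ => Nat.zero_le _).trans_eq D.sum_rowBits

theorem two_mul_one_add_sum_abs_le (D : Input m l n) (s : Fin m ⊕ Fin l) :
    2 * (1 + ∑ j, |D.rows s j|) ≤ 2 ^ D.rowBits s := by
  have hrow : 1 + ∑ j, (D.rows s j).natAbs ≤ 2 ^ ∑ j, intBits (D.rows s j) := by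
    refine (one_add_sum_le_prod_one_add _ fun _ _ => Nat.zero_le _).trans ?_
    rw [← Finset.prod_pow_eq_pow_sum]
    exact Finset.prod_le_prod' fun j _ => one_add_natAbs_le_two_pow_intBits _
  have hrhs : 2 ≤ 2 ^ intBits (D.rhs s) := le_self_pow₀ one_le_two (by rw [intBits]; omega)
  have hnat : 2 * (1 + ∑ j, (D.rows s j).natAbs) ≤ 2 ^ D.rowBits s := by
    rw [rowBits, pow_add, mul_comm]
    exact Nat.mul_le_mul hrow hrhs
  zify at hnat
  exact hnat

theorem mul_prod_rows_le {ι : Type*} [Fintype ι] (D : Input m l n) (s : Fin m ⊕ Fin l)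
    {σ : ι → Fin m ⊕ Fin l} (hσ : Function.Injective σ) :
    (1 + ∑ j, |D.rows s j|) * ∏ i, 2 * (1 + ∑ j, |D.rows (σ i) j|) ≤ 2 ^ (2 * D.bitLength) := by
  have hone : 1 + ∑ j, |D.rows s j| ≤ 2 ^ D.bitLength :=
    calc 1 + ∑ j, |D.rows s j| ≤ 2 * (1 + ∑ j, |D.rows s j|) :=
          le_mul_of_one_le_left (by positivity) one_le_two
      _ ≤ 2 ^ D.rowBits s := D.two_mul_one_add_sum_abs_le s
      _ ≤ 2 ^ D.bitLength := by
          rw [← D.sum_rowBits]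
          exact pow_le_pow_right₀ one_le_two
            (Finset.single_le_sum (fun _ _ => Nat.zero_le _) (Finset.mem_univ s))
  have hprod : ∏ i, 2 * (1 + ∑ j, |D.rows (σ i) j|) ≤ 2 ^ D.bitLength :=
    calc ∏ i, 2 * (1 + ∑ j, |D.rows (σ i) j|) ≤ ∏ i, 2 ^ D.rowBits (σ i) :=
          Finset.prod_le_prod (fun i _ => by positivity)
            fun i _ => D.two_mul_one_add_sum_abs_le (σ i)
      _ = 2 ^ ∑ i, D.rowBits (σ i) := Finset.prod_pow_eq_pow_sum _ _ _
      _ ≤ 2 ^ D.bitLength := pow_le_pow_right₀ one_le_two (D.sum_rowBits_comp_le hσ)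
  rw [two_mul, pow_add]
  gcongr

theorem nu_pos (D : Input m l n) : 0 < D.nu := by
  rw [nu]
  positivity

theorem nu_mul_le_one (D : Input m l n) {B : ℤ} (hB : B ≤ 2 ^ (2 * D.bitLength)) :
    D.nu * B ≤ 1 := by
  rw [nu, inv_mul_le_iff₀ (by positivity), mul_one]
  exact_mod_cast hB

/-- `x` solves the equations exactly and the inequalities up to `ν`: the guarantee on the points
considered by the rounding phase. -/
def IsApprox (D : Input m l n) (x : Fin n → ℝ) : Prop :=
  D.toSys.A *ᵥ x = D.toSys.b ∧ ∀ k, (D.toSys.C *ᵥ x) k < D.toSys.d k + D.nu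

/-- The step length `λ` for which the `j`-th inequality becomes tight at `x + λ w`. -/
noncomputable def stepLength (D : Input m l n) (x w : Fin n → ℝ) (j : Fin l) : ℝ :=
  (D.toSys.d j - (D.toSys.C *ᵥ x) j) / (D.toSys.C *ᵥ w) j

theorem exists_move (D : Input m l n) {x : Fin n → ℝ} {k : Fin l} (hk : k ∉ D.active x)
    (hspan : D.toSys.C k ∉ D.rowSpan Set.univ (D.active x)) :
    ∃ s', Step D (.rounding x) s' := by
  obtain ⟨w, hw, hwk⟩ := exists_dotProduct_eq_one hspan
  have hwL : ∀ i ∈ D.active x, (D.toSys.C *ᵥ w) i = 0 := fun i hi => hw _ (.inr ⟨i, hi, rfl⟩)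
  obtain ⟨j, hj, hmin⟩ := Set.exists_min_image {i | i ∉ D.active x ∧ 0 < (D.toSys.C *ᵥ w) i}
    (D.stepLength x w) (Set.toFinite _) ⟨k, hk, one_pos.trans_eq hwk.symm⟩
  exact ⟨_, .move x w k j hk hspan (funext fun i => hw _ (.inl ⟨i, trivial, rfl⟩)) hwL hwk hj.1
    hj.2 fun i hi hiw => hmin i ⟨hi, hiw⟩⟩

theorem IsApprox.lt_of_notMem_active {D : Input m l n} {x : Fin n → ℝ} (hx : D.IsApprox x)
    {k : Fin l} (hk : k ∉ D.active x) : (D.toSys.C *ᵥ x) k < D.toSys.d k := by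
  by_contra h
  exact hk ⟨not_lt.mp h, hx.2 k⟩

theorem mulVec_add_smul_apply (D : Input m l n) (x w : Fin n → ℝ) (t : ℝ) (i : Fin l) :
    (D.toSys.C *ᵥ (x + t • w)) i = (D.toSys.C *ᵥ x) i + t * (D.toSys.C *ᵥ w) i := by
  rw [Matrix.mulVec_add, Matrix.mulVec_smul, Pi.add_apply, Pi.smul_apply, smul_eq_mul]

theorem IsApprox.add_stepLength_smul {D : Input m l n} {x w : Fin n → ℝ} {j : Fin l}
    (hx : D.IsApprox x) (hwA : D.toSys.A *ᵥ w = 0)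
    (hwL : ∀ i ∈ D.active x, (D.toSys.C *ᵥ w) i = 0) (hj : j ∉ D.active x)
    (hwj : 0 < (D.toSys.C *ᵥ w) j)
    (hmin : ∀ i, i ∉ D.active x → 0 < (D.toSys.C *ᵥ w) i →
      D.stepLength x w j ≤ D.stepLength x w i) :
    D.IsApprox (x + D.stepLength x w j • w) := by
  refine ⟨?_, fun i => ?_⟩
  · rw [Matrix.mulVec_add, Matrix.mulVec_smul, hwA, smul_zero, add_zero, hx.1]
  rw [mulVec_add_smul_apply]
  by_cases hi : i ∈ D.active x
  · rw [hwL i hi, mul_zero, add_zero]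
    exact hx.2 i
  · have hle : D.stepLength x w j * (D.toSys.C *ᵥ w) i ≤ D.toSys.d i - (D.toSys.C *ᵥ x) i :=
      ratio_mul_le (sub_pos.mpr (hx.lt_of_notMem_active hj)).le
        (sub_pos.mpr (hx.lt_of_notMem_active hi)).le hwj (hmin i hi)
    linarith [D.nu_pos]

theorem active_ssubset_active_add_stepLength_smul {D : Input m l n} {x w : Fin n → ℝ} {j : Fin l}
    (hwL : ∀ i ∈ D.active x, (D.toSys.C *ᵥ w) i = 0) (hj : j ∉ D.active x)
    (hwj : 0 < (D.toSys.C *ᵥ w) j) :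
    D.active x ⊂ D.active (x + D.stepLength x w j • w) := by
  refine (Set.ssubset_iff_of_subset fun i hi => ?_).mpr ⟨j, ?_, hj⟩
  · rwa [active, Set.mem_ofPred_eq, mulVec_add_smul_apply, hwL i hi, mul_zero, add_zero]
  · rw [active, Set.mem_ofPred_eq, mulVec_add_smul_apply, stepLength,
      div_mul_cancel₀ _ hwj.ne', add_sub_cancel]
    exact ⟨le_rfl, lt_add_of_pos_right _ D.nu_pos⟩

theorem sumElim_eq_rows (D : Input m l n) (I' : Set (Fin m)) (L' : Set (Fin l)) :
    (Sum.elim (fun i : I' => D.toSys.A i) (fun k : L' => D.toSys.C k)) =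
      fun s j => (D.rows (Sum.map Subtype.val Subtype.val s) j : ℝ) := by
  ext (i | k) j <;> rfl

theorem rowSpan_eq_span_range (D : Input m l n) (I' : Set (Fin m)) (L' : Set (Fin l)) :
    D.rowSpan I' L' = Submodule.span ℝ (Set.range fun (s : I' ⊕ L') j =>
      (D.rows (Sum.map Subtype.val Subtype.val s) j : ℝ)) := by
  rw [← sumElim_eq_rows, rowSpan, Set.Sum.elim_range]
  exact congrArg₂ (fun s t => Submodule.span ℝ (s ∪ t)) (Set.image_eq_range _ _)
    (Set.image_eq_range _ _)

theorem rowSpan_empty (D : Input m l n) (I' : Set (Fin m)) :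
    D.rowSpan I' ∅ = Submodule.span ℝ (D.toSys.A '' I') :=
  congrArg (Submodule.span ℝ)
    ((congrArg (_ ∪ ·) (Set.image_empty D.toSys.C)).trans (Set.union_empty _))

theorem exists_finish (D : Input m l n) {x : Fin n → ℝ}
    (hspan : ∀ k, k ∉ D.active x → D.toSys.C k ∈ D.rowSpan Set.univ (D.active x)) :
    ∃ s', Step D (.rounding x) s' := by
  classical
  obtain ⟨I', -, L', hL, hindep, hI, hmax⟩ :=
    exists_linearIndependent_sumElim_span_eq (K := ℝ) D.toSys.A D.toSys.C Set.univ (D.active x)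
  have hrows := hindep
  rw [sumElim_eq_rows] at hrows
  obtain ⟨y, hy, -⟩ := exists_solution_abs_le ℝ hrows
    fun s => D.rhs (Sum.map Subtype.val Subtype.val s)
  exact ⟨_, .finish x y I' L' hspan hL hindep (by rwa [rowSpan_empty, rowSpan_empty]) hmax
    (fun i hi => hy (.inl ⟨i, hi⟩)) fun k hk => hy (.inr ⟨k, hk⟩)⟩

theorem IsApprox.mulVec_le_of_mem_span {ι : Type*} [Finite ι] {D : Input m l n}
    {x y : Fin n → ℝ} (hx : D.IsApprox x) {σ : ι → Fin m ⊕ Fin l} (hσ : Function.Injective σ)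
    (hindep : LinearIndependent ℝ fun i j => (D.rows (σ i) j : ℝ))
    (hxσ : ∀ i, |∑ j, (D.rows (σ i) j : ℝ) * x j - D.rhs (σ i)| ≤ D.nu)
    (hyσ : ∀ i, ∑ j, (D.rows (σ i) j : ℝ) * y j = D.rhs (σ i)) {k : Fin l}
    (hk : D.toSys.C k ∈ Submodule.span ℝ (Set.range fun i j => (D.rows (σ i) j : ℝ))) :
    (D.toSys.C *ᵥ y) k ≤ D.toSys.d k := by
  have := Fintype.ofFinite ι
  obtain ⟨Δ, μ, hΔ, hrel, hle⟩ :=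
    exists_pos_int_relation_add_sum_abs_le ℝ (u := D.rows (.inr k)) hindep hk
  exact sum_mul_le_of_int_relation hΔ hrel hyσ hxσ (hx.2 k)
    (D.nu_mul_le_one (hle.trans (D.mul_prod_rows_le (.inr k) hσ)))

theorem IsApprox.mulVec_eq_of_rowSpan_eq {D : Input m l n} {x y : Fin n → ℝ} (hx : D.IsApprox x)
    {I' : Set (Fin m)} (hI : D.rowSpan I' ∅ = D.rowSpan Set.univ ∅)
    (hyA : ∀ i ∈ I', (D.toSys.A *ᵥ y) i = D.toSys.b i) : D.toSys.A *ᵥ y = D.toSys.b := by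
  rw [rowSpan_empty, rowSpan_empty] at hI
  rw [← hx.1]
  ext i
  have hi : D.toSys.A i ∈ Submodule.span ℝ (D.toSys.A '' I') :=
    hI ▸ Submodule.subset_span ⟨i, trivial, rfl⟩
  refine dotProduct_eq_of_mem_span ?_ hi
  rintro _ ⟨i, hi, rfl⟩
  exact (hyA i hi).trans (congrFun hx.1 i).symm

theorem IsApprox.feasible_of_finish {D : Input m l n} {x y : Fin n → ℝ} (hx : D.IsApprox x)
    {I' : Set (Fin m)} {L' : Set (Fin l)}
    (hspan : ∀ k, k ∉ D.active x → D.toSys.C k ∈ D.rowSpan Set.univ (D.active x))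
    (hL : L' ⊆ D.active x)
    (hindep : LinearIndependent ℝ
      (Sum.elim (fun i : I' => D.toSys.A i) (fun k : L' => D.toSys.C k)))
    (hI : D.rowSpan I' ∅ = D.rowSpan Set.univ ∅)
    (hmax : D.rowSpan I' L' = D.rowSpan Set.univ (D.active x))
    (hyA : ∀ i ∈ I', (D.toSys.A *ᵥ y) i = D.toSys.b i)
    (hyL : ∀ k ∈ L', (D.toSys.C *ᵥ y) k = D.toSys.d k) : D.toSys.Feasible y := by
  classical
  refine ⟨hx.mulVec_eq_of_rowSpan_eq hI hyA, fun k => ?_⟩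
  have hk : D.toSys.C k ∈ D.rowSpan I' L' := by
    rw [hmax]
    by_cases hk : k ∈ D.active x
    · exact Submodule.subset_span (.inr ⟨k, hk, rfl⟩)
    · exact hspan k hk
  rw [sumElim_eq_rows] at hindep
  rw [rowSpan_eq_span_range] at hk
  refine hx.mulVec_le_of_mem_span (Subtype.val_injective.sumMap Subtype.val_injective) hindep
    ?_ ?_ hk
  · rintro (i | k)
    · have hi : (D.toSys.A *ᵥ x) i - D.toSys.b i = 0 := sub_eq_zero.mpr (congrFun hx.1 i)
      exact (abs_eq_zero.mpr hi).trans_le D.nu_pos.le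
    · have hactive := hL k.2
      have hk : |(D.toSys.C *ᵥ x) k - D.toSys.d k| ≤ D.nu := by
        rw [abs_of_nonneg (sub_nonneg.mpr hactive.1)]
        exact (sub_left_lt_of_lt_add hactive.2).le
      exact hk
  · rintro (i | k)
    · exact hyA i i.2
    · exact hyL k k.2

end Input

/-! ## Runs of the LFG algorithm -/

variable {m l n : ℕ}

namespace Input

theorem dcSys_A_mulVec (D : Input m l n) (y : Fin n ⊕ Unit → ℝ) (i : Fin m) :
    (D.dcSys.A *ᵥ y) i = (D.toSys.A *ᵥ (y ∘ Sum.inl)) i - D.toSys.b i * y (.inr ()) := by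
  simp [dcSys, LinSys.strengthen, LinSys.parameterize, LinSys.relax, Matrix.mulVec, dotProduct,
    sub_eq_add_neg]

theorem dcSys_C_mulVec_inl (D : Input m l n) (y : Fin n ⊕ Unit → ℝ) (k : Fin l) :
    (D.dcSys.C *ᵥ y) (.inl k) =
      (D.toSys.C *ᵥ (y ∘ Sum.inl)) k - (D.toSys.d k + D.nu / 2) * y (.inr ()) := by
  simp [dcSys, LinSys.strengthen, LinSys.parameterize, LinSys.relax, Matrix.mulVec, dotProduct]
  ring

theorem dcSys_C_mulVec_inr (D : Input m l n) (y : Fin n ⊕ Unit → ℝ) :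
    (D.dcSys.C *ᵥ y) (.inr ()) = -y (.inr ()) := by
  simp [dcSys, LinSys.strengthen, LinSys.parameterize, LinSys.relax, Matrix.mulVec, dotProduct]

theorem dcSys_b (D : Input m l n) : D.dcSys.b = 0 := rfl

theorem dcSys_d_inl (D : Input m l n) (k : Fin l) : D.dcSys.d (.inl k) = -1 := zero_sub 1

theorem dcSys_d_inr (D : Input m l n) : D.dcSys.d (.inr ()) = -2 := by
  change (-1 : ℝ) - 1 = -2
  norm_num

theorem nu_le_one (D : Input m l n) : D.nu ≤ 1 :=
  inv_le_one_of_one_le₀ (one_le_pow₀ one_le_two)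

theorem add_nu_div_two_ne_zero (D : Input m l n) (a : ℤ) : (a : ℝ) + D.nu / 2 ≠ 0 := by
  intro h
  have hneg : a < 0 := by exact_mod_cast (by linarith [D.nu_pos] : (a : ℝ) < 0)
  have hgt : -1 < a := by exact_mod_cast (by linarith [D.nu_le_one] : (-1 : ℝ) < a)
  omega

theorem dcSys_row_ne_zero (D : Input m l n) (k : Fin l ⊕ Unit) : D.dcSys.row k ≠ 0 := by
  intro h
  have hlast : D.dcSys.C k (.inr ()) = 0 := congrArg (fun v => v.ofLp (.inr ())) h
  cases k with
  | inl k => exact D.add_nu_div_two_ne_zero (D.d k) (neg_eq_zero.mp hlast)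
  | inr => exact one_ne_zero (neg_eq_zero.mp hlast)

theorem dcSys_normCmax_pos (D : Input m l n) : 0 < D.dcSys.normCmax :=
  (norm_pos_iff.mpr (D.dcSys_row_ne_zero (.inr ()))).trans_le (D.dcSys.norm_row_le _)

theorem dcSys_isRationalPolyhedron (D : Input m l n) :
    IsRationalPolyhedron {y | D.dcSys.Feasible y} := by
  obtain ⟨ν, hν⟩ : ∃ q : ℚ, (q : ℝ) = D.nu :=
    ⟨(2 ^ (2 * D.bitLength))⁻¹, by rw [nu]; push_cast; rfl⟩
  refine LinSys.isRationalPolyhedron ?_ ?_ ?_ ?_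
  · rintro i (j | j)
    · exact ⟨D.A i j, by push_cast; rfl⟩
    · exact ⟨-D.b i, by push_cast; rfl⟩
  · exact fun i => ⟨0, by push_cast; rfl⟩
  · rintro (k | k) (j | j)
    · exact ⟨D.C k j, by push_cast; rfl⟩
    · exact ⟨-(D.d k + ν / 2), by push_cast; rw [hν]; rfl⟩
    · exact ⟨0, by push_cast; rfl⟩
    · exact ⟨-1, by push_cast; rfl⟩
  · rintro (k | k)
    · exact ⟨-1, by rw [dcSys_d_inl]; norm_num⟩
    · exact ⟨-2, by rw [dcSys_d_inr]; norm_num⟩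

-- With `t = 2 / ν`, the relaxation by `ν / 2` pays exactly for the strengthening by `1`.
theorem exists_dcSys_feasible (D : Input m l n) {x : Fin n → ℝ} (hx : D.toSys.Feasible x) :
    ∃ y, D.dcSys.Feasible y := by
  have hν := D.nu_pos
  set t := 2 / D.nu
  have ht : 2 ≤ t := (le_div_iff₀ hν).mpr (by linarith [D.nu_le_one])
  have hνt : D.nu / 2 * t = 1 := by simp only [t]; field_simp
  refine ⟨Sum.elim (t • x) fun _ => t, funext fun i => ?_, ?_⟩
  · rw [dcSys_A_mulVec, Sum.elim_comp_inl, Matrix.mulVec_smul, hx.1, dcSys_b, Sum.elim_inr,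
      Pi.smul_apply, smul_eq_mul, mul_comm, sub_self, Pi.zero_apply]
  · rintro (k | k)
    · have hk : t * (D.toSys.C *ᵥ x) k ≤ t * D.toSys.d k := by
        gcongr
        exact hx.2 k
      rw [dcSys_C_mulVec_inl, Sum.elim_comp_inl, Matrix.mulVec_smul, dcSys_d_inl, Sum.elim_inr,
        Pi.smul_apply, smul_eq_mul, add_mul, hνt]
      linarith
    · rw [dcSys_C_mulVec_inr, dcSys_d_inr, Sum.elim_inr]
      linarith

theorem isApprox_of_isSound (D : Input m l n) {z y : EuclideanSpace ℝ (Fin n ⊕ Unit)} {r : ℝ}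
    (h : (Outcome.solution y).IsSound D.dcSys 1 z r) :
    D.IsApprox fun j => y.ofLp (.inl j) / y.ofLp (.inr ()) := by
  obtain ⟨hA, hC⟩ := h
  set t := y.ofLp (.inr ()) with ht
  have htpos : 0 < t := by
    have hlast := hC (.inr ())
    rw [dcSys_C_mulVec_inr, dcSys_d_inr] at hlast
    linarith
  have hx : (fun j => y.ofLp (.inl j) / t) = t⁻¹ • (y.ofLp ∘ Sum.inl) := by
    funext j
    exact div_eq_inv_mul _ _
  rw [hx]
  refine ⟨funext fun i => ?_, fun k => ?_⟩
  · have hi := congrFun hA i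
    rw [dcSys_A_mulVec, dcSys_b, Pi.zero_apply, ← ht, sub_eq_zero] at hi
    rw [Matrix.mulVec_smul, Pi.smul_apply, smul_eq_mul, inv_mul_eq_iff_eq_mul₀ htpos.ne', hi,
      mul_comm]
  · have hk := hC (.inl k)
    rw [dcSys_C_mulVec_inl, dcSys_d_inl, ← ht] at hk
    rw [Matrix.mulVec_smul, Pi.smul_apply, smul_eq_mul, inv_mul_lt_iff₀ htpos]
    linarith [mul_pos D.nu_pos htpos]

theorem not_feasible_of_separates (D : Input m l n) {h : EuclideanSpace ℝ (Fin n ⊕ Unit)} {δ : ℝ}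
    (hs : D.dcSys.Separates 0 D.radius h δ) : ¬ ∃ x, D.toSys.Feasible x := by
  rintro ⟨x, hx⟩
  obtain ⟨y, hy, hnorm⟩ :=
    D.dcSys_isRationalPolyhedron.exists_norm_lt_schrijverRadius (D.exists_dcSys_feasible hx)
  obtain ⟨hne, hvalid, hdist⟩ := hs
  rw [inner_zero_right, zero_sub] at hdist
  refine lt_irrefl (-δ) ?_
  calc -δ ≤ -inner ℝ h y := neg_le_neg (hvalid y hy)
    _ ≤ ‖h‖ * ‖y‖ := (neg_le_abs _).trans (abs_real_inner_le_norm h y)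
    _ < ‖h‖ * D.radius := mul_lt_mul_of_pos_left hnorm (norm_pos_iff.mpr hne)
    _ = D.radius * ‖h‖ := mul_comm _ _
    _ ≤ -δ := hdist

end Input

/-- The invariant of a run of the LFG algorithm. -/
def State.IsSound (D : Input m l n) : State n → Prop
  | .start => True
  | .dc s => s.IsSound D.dcSys 1 0 D.radius
  | .rounding x => D.IsApprox x
  | .feasible x => D.toSys.Feasible x
  | .infeasible => ¬ ∃ x, D.toSys.Feasible x

theorem State.IsSound.step {D : Input m l n} {s s' : State n} (hs : s.IsSound D)
    (h : Step D s s') : s'.IsSound D := by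
  cases h with
  | init => exact ⟨schrijverRadius_pos _, rfl, rfl⟩
  | dc _ _ hstep => exact DCState.IsSound.step D.dcSys_row_ne_zero hs hstep
  | found y =>
    obtain ⟨z, r, -, -, hy⟩ := hs
    exact D.isApprox_of_isSound hy
  | separated h δ =>
    obtain ⟨z, r, -, ⟨rfl, rfl⟩, hsep⟩ := hs
    exact D.not_feasible_of_separates hsep
  | failed =>
    obtain ⟨z, r, -, -, hinfeasible⟩ := hs
    rintro ⟨x, hx⟩
    obtain ⟨y, hy⟩ := D.exists_dcSys_feasible hx
    exact hinfeasible y hy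
  | move x w k j hk hspan hwA hwL hwk hj hwj hmin =>
    exact Input.IsApprox.add_stepLength_smul hs hwA hwL hj hwj hmin
  | finish x y I' L' hspan hL hindep hI hmax hyA hyL =>
    exact Input.IsApprox.feasible_of_finish hs hspan hL hindep hI hmax hyA hyL

theorem State.IsSound.progress {D : Input m l n} {s : State n} (hs : s.IsSound D) :
    (∃ s', Step D s s') ∨ (∃ x, s = .feasible x) ∨ s = .infeasible := by
  match s, hs with
  | .start, _ => exact .inl ⟨_, .init⟩
  | .dc s, hs =>
    refine .inl ?_
    rcases DCState.IsSound.progress ⟨0, Matrix.mulVec_zero _⟩ hs with ⟨s', h⟩ | ⟨o, rfl⟩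
    · exact ⟨_, .dc s s' h⟩
    · cases o with
      | solution y => exact ⟨_, .found y⟩
      | hyperplane h δ => exact ⟨_, .separated h δ⟩
      | failure => exact ⟨_, .failed⟩
  | .rounding x, _ =>
    refine .inl ?_
    by_cases hspan : ∀ k, k ∉ D.active x → D.toSys.C k ∈ D.rowSpan Set.univ (D.active x)
    · exact D.exists_finish hspan
    · push Not at hspan
      obtain ⟨k, hk, hnotMem⟩ := hspan
      exact D.exists_move hk hnotMem
  | .feasible x, _ => exact .inr (.inl ⟨x, rfl⟩)
  | .infeasible, _ => exact .inr (.inr rfl)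

/-- An upper bound for the number of steps of the LFG algorithm from a given configuration: those
of D&C, then at most one step of rounding for each inequality that can still become active. -/
noncomputable def State.stepBound (D : Input m l n) : State n → ℕ
  | .start => DCState.stepBound (1 / (2 * D.dcSys.normCmax))
      (.call (0 : EuclideanSpace ℝ (Fin n ⊕ Unit)) D.radius []) + l + 3
  | .dc s => s.stepBound (1 / (2 * D.dcSys.normCmax)) + l + 2
  | .rounding x => l - (D.active x).ncard + 1
  | .feasible _ => 0
  | .infeasible => 0

theorem Step.stepBound_lt {D : Input m l n} {s s' : State n} (h : Step D s s') :
    s'.stepBound D < s.stepBound D := by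
  cases h with
  | init => simp only [State.stepBound]; omega
  | dc _ _ hstep =>
    have hlt := hstep.stepBound_lt (one_div_pos.mpr (mul_pos two_pos D.dcSys_normCmax_pos))
    simp only [State.stepBound]
    omega
  | found y => simp only [State.stepBound]; omega
  | separated h δ => simp only [State.stepBound]; omega
  | failed => simp only [State.stepBound]; omega
  | move x w k j hk hspan hwA hwL hwk hj hwj hmin =>
    have hlt := Set.ncard_lt_ncard (Input.active_ssubset_active_add_stepLength_smul hwL hj hwj)
    have hle := Set.ncard_le_card (D.active (x + D.stepLength x w j • w))
    rw [Nat.card_fin] at hle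
    rw [Input.stepLength] at hlt hle
    simp only [State.stepBound]
    omega
  | finish => simp only [State.stepBound]; omega

theorem StepsTo.isSound {D : Input m l n} {N : ℕ} {s : State n} (h : StepsTo D N s) :
    s.IsSound D := by
  induction h with
  | zero => trivial
  | succ _ _ _ _ hstep ih => exact ih.step hstep

theorem StepsTo.add_stepBound_le {D : Input m l n} {N : ℕ} {s : State n} (h : StepsTo D N s) :
    N + s.stepBound D ≤ State.stepBound D .start := by
  induction h with
  | zero => exact (Nat.zero_add _).le
  | succ _ _ _ _ hstep ih =>
    have hlt := hstep.stepBound_lt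
    omega

end LFG

theorem mainTheorem5 (m l n : ℕ) (D : LFG.Input m l n) :
    (∃ B : ℕ, ∀ (N : ℕ) (s : LFG.State n), LFG.StepsTo D N s → N ≤ B) ∧
    (∀ (N : ℕ) (s : LFG.State n), LFG.StepsTo D N s → (¬ ∃ s', LFG.Step D s s') →
      (∃ x, s = .feasible x ∧ D.toSys.Feasible x) ∨
      (s = .infeasible ∧ ¬ ∃ x, D.toSys.Feasible x)) := by
  refine ⟨⟨LFG.State.stepBound D .start,
    fun N s h => (Nat.le_add_right _ _).trans h.add_stepBound_le⟩, fun N s h hstuck => ?_⟩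
  rcases h.isSound.progress with hstep | ⟨x, rfl⟩ | rfl
  · exact absurd hstep hstuck
  · exact .inl ⟨x, rfl, h.isSound⟩
  · exact .inr ⟨rfl, h.isSound⟩
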